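/- Let $V$ and $H$ be real Hilbert spaces, $V\subset H$ dense with continuous injection, $H$ identified with its dual $H'$, so that $V\subset H\subset V'$; let $\langle\cdot,\cdot\rangle$ be the duality pairing between $V'$ and $V$ and $(\cdot,\cdot)$ the inner product of $H$. Let $J=(0,T)$ with $0<T<\infty$, and let $M,\alpha>0$. For a.e. $t\in J$ let $A(t):V\to V'$ be a linear operator with $$\langle A(t)w,v\rangle\le M\|w\|_V\|v\|_V,\qquad \langle A(t)v,v\rangle\ge\alpha\|v\|_V^2\qquad(w,v\in V),$$ such that $t\mapsto\langle A(t)w,v\rangle$ is measurable on $J$ for all $w,v\in V$. Let $\mathcal X=L^2(J;V)\cap H^1(J;V')$ be the space of all $u\in L^2(J;V)$ whose $V'$-valued distributional derivative $u'$ lies in $L^2(J;V')$, with the norm $\|u\|_{\mathcal X}^2=\|u\|_{L^2(J;V)}^2+\|u'\|_{L^2(J;V')}^2$. For $u\in\mathcal X$, let $u(0)\in H$ denote the value at $0$ of the representative of $u$ that is continuous from $[0,T]$ to $H$. Then for every $f\in L^2(J;V')$ and $u_0\in H$ there is a unique $u\in\mathcal X$ such that $$\int_J\bigl[\langle u',v_1\rangle+\langle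 A(t)u,v_1\rangle\bigr]\,dt+(u(0),v_2)=\int_J\langle f,v_1\rangle\,dt+(u_0,v_2)\qquad\text{for all }(v_1,v_2)\in L^2(J;V)\times H$$ (the weak form of $u'+A(t)u=f$ in $J$, $u(0)=u_0$), and it satisfies $$\|u\|_{\mathcal X}\le C\bigl(\|f\|_{L^2(J;V')}+\|u_0\|_H\bigr),$$ where $C>0$ is a constant depending only on $M$ and $\alpha$. -/

import Mathlib

open MeasureTheory Set
open scoped ContDiff RealInnerProductSpace

namespace Parabolic

noncomputable section

/-- The Bochner space `L²(J; E)` on the time interval `J = (0, T)`. -/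
abbrev L2 (T : ℝ) (E : Type*) [NormedAddCommGroup E] : Type _ :=
  Lp E 2 ((volume : Measure ℝ).restrict (Ioo 0 T))

section Triple

variable {H : Type*} [NormedAddCommGroup H] [InnerProductSpace ℝ H]
  {V : Type*} [NormedAddCommGroup V] [InnerProductSpace ℝ V]

/-- The map `V → V'` of the triple `V ⊂ H ⊂ V'`, where `ι` is the injection `V → H` and `H` is
identified with `H'`: the element `v` of `V` is sent to the functional `w ↦ (v, w)_H`. -/
def embDual (ι : V →L[ℝ] H) (v : V) : StrongDual ℝ V :=
  (innerSL ℝ (ι v)).comp ι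

/-- `g ∈ L²(J; V')` is the derivative of `u ∈ L²(J; V)`, regarded as a `V'`-valued function, in the
sense of `V'`-valued distributions on `J = (0, T)`. -/
def HasWeakDeriv (ι : V →L[ℝ] H) (T : ℝ) (u : L2 T V) (g : L2 T (StrongDual ℝ V)) : Prop :=
  ∀ φ : ℝ → ℝ, ContDiff ℝ ∞ φ → HasCompactSupport φ → tsupport φ ⊆ Ioo 0 T →
    ∫ t in Ioo 0 T, deriv φ t • embDual ι (u t) = -∫ t in Ioo 0 T, φ t • g t

/-- The space `𝒳 = L²(J; V) ∩ H¹(J; V')`. -/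
def SpaceX (ι : V →L[ℝ] H) (T : ℝ) : Set (L2 T V) :=
  {u | ∃ g : L2 T (StrongDual ℝ V), HasWeakDeriv ι T u g}

/-- The weak derivative `u' ∈ L²(J; V')` of `u ∈ 𝒳`. -/
def weakDeriv {ι : V →L[ℝ] H} {T : ℝ} (u : SpaceX ι T) : L2 T (StrongDual ℝ V) :=
  u.2.choose

/-- The norm of `𝒳`: `‖u‖² = ‖u‖²_{L²(J; V)} + ‖u'‖²_{L²(J; V')}`. -/
def normX {ι : V →L[ℝ] H} {T : ℝ} (u : SpaceX ι T) : ℝ :=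
  Real.sqrt (‖(u : L2 T V)‖ ^ 2 + ‖weakDeriv u‖ ^ 2)

/-- `u(0) = h`, where `u(0) ∈ H` is the value at `0` of the representative of `u` that is
continuous from `[0, T]` to `H`. -/
def IsInitialValue (ι : V →L[ℝ] H) (T : ℝ) (u : L2 T V) (h : H) : Prop :=
  ∃ U : ℝ → H, ContinuousOn U (Icc 0 T) ∧
    (∀ᵐ t ∂(volume : Measure ℝ).restrict (Ioo 0 T), U t = ι (u t)) ∧ U 0 = h

/-- `u ∈ 𝒳` solves the weak problem: for all `(v₁, v₂) ∈ L²(J; V) × H`,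
`∫_J [⟨u', v₁⟩ + ⟨A(t) u, v₁⟩] dt + (u(0), v₂) = ∫_J ⟨f, v₁⟩ dt + (u₀, v₂)`. -/
def IsSolution (ι : V →L[ℝ] H) (T : ℝ) (A : ℝ → V →ₗ[ℝ] StrongDual ℝ V)
    (f : L2 T (StrongDual ℝ V)) (u₀ : H) (u : SpaceX ι T) : Prop :=
  ∃ h : H, IsInitialValue ι T (u : L2 T V) h ∧
    ∀ (v₁ : L2 T V) (v₂ : H),
      (∫ t in Ioo 0 T,
          (weakDeriv u t (v₁ t) + A t ((u : L2 T V) t) (v₁ t))) + ⟪h, v₂⟫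
        = (∫ t in Ioo 0 T, f t (v₁ t)) + ⟪u₀, v₂⟫

/-- The weak derivative is unique. -/
theorem HasWeakDeriv.unique {ι : V →L[ℝ] H} {T : ℝ} {u : L2 T V} {g₁ g₂ : L2 T (StrongDual ℝ V)}
    (h₁ : HasWeakDeriv ι T u g₁) (h₂ : HasWeakDeriv ι T u g₂) : g₁ = g₂ := by
  have hi : ∀ g : L2 T (StrongDual ℝ V), IntegrableOn g (Ioo 0 T) := fun g =>
    (Lp.memLp g).integrable (by norm_num)
  have key : ∀ᵐ t, t ∈ Ioo 0 T → (g₁ t - g₂ t : StrongDual ℝ V) = 0 := by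
    refine isOpen_Ioo.ae_eq_zero_of_integral_contDiff_smul_eq_zero
      (f := fun t => (g₁ t - g₂ t : StrongDual ℝ V))
      ((hi g₁).sub (hi g₂)).locallyIntegrableOn ?_
    intro φ hφ hc hs
    have hI : ∀ g : L2 T (StrongDual ℝ V), IntegrableOn (fun t => φ t • g t) (Ioo 0 T) := by
      intro g
      obtain ⟨K, hK⟩ := hc.exists_bound_of_continuous hφ.continuous
      exact (hi g).bdd_smul K hφ.continuous.aestronglyMeasurable (Filter.Eventually.of_forall hK)
    have h0 : ∫ t in Ioo 0 T, φ t • (g₁ t - g₂ t : StrongDual ℝ V) = 0 := by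
      simp only [smul_sub]
      rw [integral_sub (hI g₁) (hI g₂)]
      have := (h₁ φ hφ hc hs).symm.trans (h₂ φ hφ hc hs)
      rw [neg_inj.mp this, sub_self]
    rw [← h0]
    refine (setIntegral_eq_integral_of_forall_compl_eq_zero fun t ht => ?_).symm
    rw [image_eq_zero_of_notMem_tsupport (fun h => ht (hs h)), zero_smul]
  refine Lp.ext ?_
  rw [Filter.EventuallyEq, ae_restrict_iff' measurableSet_Ioo]
  filter_upwards [key] with t ht h
  exact sub_eq_zero.mp (ht h)

/-- `weakDeriv u` is the weak derivative of `u`. -/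
theorem hasWeakDeriv_iff {ι : V →L[ℝ] H} {T : ℝ} (u : SpaceX ι T) (g : L2 T (StrongDual ℝ V)) :
    HasWeakDeriv ι T (u : L2 T V) g ↔ weakDeriv u = g :=
  ⟨fun h => HasWeakDeriv.unique u.2.choose_spec h, fun h => h ▸ u.2.choose_spec⟩

end Triple

end

end Parabolic

universe u v

/-!
The triple `V ⊂ H ⊂ V'` is turned into an equation in `V` alone: by the Riesz isomorphism `V' ≃ V`
the map `V → V'` becomes the positive injective operator `S = ι† ι`, and a pair `u`, `u'` is a pair
`u`, `q` in `L²(J; V)` for which `S u(t) = c + ∫₀ᵗ q` almost everywhere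
(`hasWeakDeriv_iff_primitive`, which is the du Bois-Reymond lemma together with Fubini). The
operators `A(t)` enter only through the bounded coercive operator `𝒜` on `L²(J; V)` that represents
`∫ ⟨A(t) w, v⟩ dt` (`exists_form_operator`), so the problem reads `q = f - 𝒜 u`, `u(0) = u₀`
(`isSolution_iff`).

*Existence and the estimate* (`exists_primitive_solution`) follow from Lions' projection argument.
The equation is tested with `K ψ = ∫ₜᵀ ψ`, `ψ ∈ L²(J; V)`. It takes the form `⟪u, B ψ⟫ = L ψ` with
`B = S + 𝒜† K`, and coercivity gives `α ‖K ψ‖² + ‖ι ∫ ψ‖² / 2 ≤ ⟪K ψ, B ψ⟫`, because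
`∫ (ι K ψ, ι ψ) = ‖ι ∫ ψ‖² / 2`. Hence `|L ψ| ≤ (‖f‖ / α + √(2 / α) ‖u₀‖) ‖B ψ‖`, and the
Hahn-Banach and Riesz theorems yield `u` with this norm bound, which does not involve `T`. As the
functions `ψ` are arbitrary, the tested equation is exactly `S u(t) = ι† u₀ + ∫₀ᵗ (f - 𝒜 u)`.

*Trace and uniqueness* rest on `exists_continuous_representative`, the embedding of `𝒳` into
`C([0, T]; H)` with the identity `‖u(T)‖² - ‖u(0)‖² = 2 ∫ ⟨u', u⟩`. There the primitive
`G = c + ∫ q` is regularized by the resolvents `J n = (S + ε)⁻¹`: the functions `ι J n G` are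
`H`-valued primitives, for which the identity is elementary, and applied to differences it shows
that they are uniformly Cauchy. The difference `z` of two solutions has `z(0) = 0` and `z' = -𝒜 z`,
so `0 ≤ ‖z(T)‖² = -2 ⟪𝒜 z, z⟫ ≤ -2 α ‖z‖²`.
-/

namespace Parabolic

/-! ### Integration by parts for primitives of integrable functions -/

section Primitive

variable {E : Type*} [NormedAddCommGroup E] [InnerProductSpace ℝ E]

/-- Integration by parts for the two primitives `∫ t in a..s, q t` and `∫ s in t..b, p s`; both sides
are the integral of `⟪q t, p s⟫` over the triangle `t < s`. -/
theorem integral_inner_integral_right_swap [CompleteSpace E] {a b : ℝ} (hab : a ≤ b) {q p : ℝ → E}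
    (hq : IntervalIntegrable q volume a b) (hp : IntervalIntegrable p volume a b) :
    ∫ t in a..b, ⟪q t, ∫ s in t..b, p s⟫ = ∫ s in a..b, ⟪∫ t in a..s, q t, p s⟫ := by
  have hq' : IntegrableOn q (Ioc a b) := (intervalIntegrable_iff_integrableOn_Ioc_of_le hab).1 hq
  have hp' : IntegrableOn p (Ioc a b) := (intervalIntegrable_iff_integrableOn_Ioc_of_le hab).1 hp
  set μ := (volume : Measure ℝ).restrict (Ioc a b) with hμ
  let Φ : ℝ × ℝ → ℝ := {z : ℝ × ℝ | z.1 < z.2}.indicator fun z => ⟪q z.1, p z.2⟫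
  have hms : MeasurableSet {z : ℝ × ℝ | z.1 < z.2} := measurableSet_lt measurable_fst measurable_snd
  have hΦ : Integrable Φ (μ.prod μ) := by
    refine Integrable.indicator ?_ hms
    refine (Integrable.mul_prod hq'.norm hp'.norm).mono'
      (hq'.aestronglyMeasurable.comp_fst.inner hp'.aestronglyMeasurable.comp_snd) ?_
    exact Filter.Eventually.of_forall fun z => norm_inner_le_norm _ _
  have hswap := integral_integral_swap (f := fun t s => Φ (t, s)) hΦ
  rw [intervalIntegral.integral_of_le hab, intervalIntegral.integral_of_le hab]
  have h1 : ∀ t ∈ Ioc a b, ⟪q t, ∫ s in t..b, p s⟫ = ∫ s, Φ (t, s) ∂μ := by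
    intro t ht
    have : (fun s => Φ (t, s)) = (Ioi t).indicator fun s => ⟪q t, p s⟫ := by
      ext s
      by_cases h : t < s <;> simp [Φ, indicator, h]
    rw [this, integral_indicator measurableSet_Ioi, hμ, Measure.restrict_restrict measurableSet_Ioi,
      show Ioi t ∩ Ioc a b = Ioc t b by
        ext s; simp only [mem_inter_iff, mem_Ioi, mem_Ioc]
        exact ⟨fun h => ⟨h.1, h.2.2⟩, fun h => ⟨h.1, ht.1.trans h.1, h.2⟩⟩,
      integral_inner (hp'.mono_set (Ioc_subset_Ioc_left ht.1.le)),
      intervalIntegral.integral_of_le ht.2]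
  have h2 : ∀ s ∈ Ioc a b, ⟪∫ t in a..s, q t, p s⟫ = ∫ t, Φ (t, s) ∂μ := by
    intro s hs
    have : (fun t => Φ (t, s)) = (Iio s).indicator fun t => ⟪p s, q t⟫ := by
      ext t
      by_cases h : t < s <;> simp [Φ, indicator, h, real_inner_comm]
    rw [this, integral_indicator measurableSet_Iio, hμ, Measure.restrict_restrict measurableSet_Iio,
      show Iio s ∩ Ioc a b = Ioo a s by
        ext t; simp only [mem_inter_iff, mem_Iio, mem_Ioc, mem_Ioo]
        exact ⟨fun h => ⟨h.2.1, h.1⟩, fun h => ⟨h.2, h.1, h.2.le.trans hs.2⟩⟩,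
      integral_inner (hq'.mono_set ((Ioo_subset_Ioc_self).trans (Ioc_subset_Ioc_right hs.2))),
      intervalIntegral.integral_of_le hs.1.le, integral_Ioc_eq_integral_Ioo, real_inner_comm]
  rw [setIntegral_congr_fun measurableSet_Ioc h1, setIntegral_congr_fun measurableSet_Ioc h2]
  exact hswap

theorem intervalIntegrable_inner_of_continuousOn {a b : ℝ} {q x : ℝ → E} (hab : a ≤ b)
    (hq : IntervalIntegrable q volume a b) (hx : ContinuousOn x (Icc a b)) :
    IntervalIntegrable (fun t => ⟪q t, x t⟫) volume a b := by
  rw [intervalIntegrable_iff_integrableOn_Ioc_of_le hab] at hq ⊢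
  obtain ⟨K, hK⟩ := isCompact_Icc.exists_bound_of_continuousOn hx
  have hxm : AEStronglyMeasurable x (volume.restrict (Ioc a b)) :=
    (hx.mono Ioc_subset_Icc_self).aestronglyMeasurable measurableSet_Ioc
  refine (hq.norm.mul_const K).mono' (hq.aestronglyMeasurable.inner hxm) ?_
  refine (ae_restrict_iff' measurableSet_Ioc).2 (Filter.Eventually.of_forall fun t ht => ?_)
  exact (norm_inner_le_norm _ _).trans
    (mul_le_mul_of_nonneg_left (hK t (Ioc_subset_Icc_self ht)) (norm_nonneg _))

theorem continuousOn_const_add_integral [CompleteSpace E] {a b : ℝ} (hab : a ≤ b) {q : ℝ → E}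
    (hq : IntervalIntegrable q volume a b) (c : E) :
    ContinuousOn (fun t => c + ∫ s in a..t, q s) (Icc a b) := by
  refine continuousOn_const.add ?_
  have := intervalIntegral.continuousOn_primitive_interval (μ := volume) (f := q) (a := a) (b := b)
    (by rw [uIcc_of_le hab]; exact (intervalIntegrable_iff_integrableOn_Icc_of_le hab).1 hq)
  rwa [uIcc_of_le hab] at this

/-- Energy identity for the primitive `x t = c + ∫ s in a..t, q s` of an integrable function. -/
theorem two_mul_integral_inner_primitive [CompleteSpace E] {a b : ℝ} (hab : a ≤ b) {q : ℝ → E}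
    (hq : IntervalIntegrable q volume a b) (c : E) :
    2 * ∫ t in a..b, ⟪q t, c + ∫ s in a..t, q s⟫ = ‖c + ∫ s in a..b, q s‖ ^ 2 - ‖c‖ ^ 2 := by
  have hcont := continuousOn_const_add_integral hab hq 0
  simp only [zero_add] at hcont
  have hI := intervalIntegrable_inner_of_continuousOn hab hq hcont
  have hc : IntervalIntegrable (fun t => ⟪q t, c⟫) volume a b :=
    intervalIntegrable_inner_of_continuousOn hab hq continuousOn_const
  have hy : IntervalIntegrable (fun t => ⟪q t, ∫ s in a..b, q s⟫) volume a b :=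
    intervalIntegrable_inner_of_continuousOn hab hq continuousOn_const
  have hconst : ∀ d : E, ∫ t in a..b, ⟪q t, d⟫ = ⟪∫ t in a..b, q t, d⟫ := by
    intro d
    have h : ∫ t in Ioc a b, ⟪d, q t⟫ = ⟪d, ∫ t in Ioc a b, q t⟫ :=
      integral_inner ((intervalIntegrable_iff_integrableOn_Ioc_of_le hab).1 hq) d
    simpa only [intervalIntegral.integral_of_le hab, real_inner_comm d] using h
  have key := integral_inner_integral_right_swap hab hq hq
  -- On the left `∫ s in t..b` is the full integral minus the primitive at `t`.
  have hleft : ∫ t in a..b, ⟪q t, ∫ s in t..b, q s⟫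
      = (∫ t in a..b, ⟪q t, ∫ s in a..b, q s⟫) - ∫ t in a..b, ⟪q t, ∫ s in a..t, q s⟫ := by
    rw [← intervalIntegral.integral_sub hy hI]
    refine intervalIntegral.integral_congr fun t ht => ?_
    rw [uIcc_of_le hab] at ht
    have h1 : IntervalIntegrable q volume a t :=
      hq.mono_set (by rw [uIcc_of_le hab, uIcc_of_le ht.1]; exact Icc_subset_Icc_right ht.2)
    simp only [← inner_sub_right]
    rw [intervalIntegral.integral_interval_sub_left hq h1]
  have hright : ∫ s in a..b, ⟪∫ t in a..s, q t, q s⟫ = ∫ t in a..b, ⟪q t, ∫ s in a..t, q s⟫ := by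
    exact intervalIntegral.integral_congr fun t _ => real_inner_comm _ _
  rw [hleft, hright, hconst] at key
  simp only [inner_add_right]
  rw [intervalIntegral.integral_add hc hI, hconst, norm_add_sq_real,
    ← real_inner_self_eq_norm_sq (∫ s in a..b, q s), real_inner_comm c]
  linarith

end Primitive

/-! ### Regularization by resolvents -/

section Resolvent

open ContinuousLinearMap Filter Topology

variable {V : Type*} [NormedAddCommGroup V] [InnerProductSpace ℝ V] [CompleteSpace V]

/-- For a bounded symmetric, positive, injective operator `S` there are bounded symmetric operators
`J n`, commuting with `S`, for which `S (J n x) → x` boundedly. They are the resolvents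
`(S + ε)⁻¹` with `ε = 1 / (n + 1)`, for which `x - S (J n x) = ε • J n x`. -/
theorem exists_approx_inverse (S : V →L[ℝ] V) (hsymm : ∀ x y, ⟪S x, y⟫ = ⟪x, S y⟫)
    (hpos : ∀ x, 0 ≤ ⟪S x, x⟫) (hinj : Function.Injective S) :
    ∃ J : ℕ → V →L[ℝ] V, (∀ n x, J n (S x) = S (J n x)) ∧
      (∀ n x y, ⟪J n x, y⟫ = ⟪x, J n y⟫) ∧
      (∀ n x, ‖x - S (J n x)‖ ≤ ‖x‖) ∧
      ∀ x, Tendsto (fun n => x - S (J n x)) atTop (𝓝 0) := by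
  have hε : ∀ n : ℕ, (0 : ℝ) < 1 / ((n : ℝ) + 1) := fun n => Nat.one_div_pos_of_nat
  have hinv : ∀ n : ℕ, ∃ J : V →L[ℝ] V, (∀ x, J (S x + (1 / ((n : ℝ) + 1)) • x) = x) ∧
      ∀ x, S (J x) + (1 / ((n : ℝ) + 1)) • J x = x := by
    intro n
    have hu : IsUnit (S + (1 / ((n : ℝ) + 1)) • ContinuousLinearMap.id ℝ V) := by
      refine isUnit_of_forall_le_norm_inner_map _ (c := ⟨1 / ((n : ℝ) + 1), (hε n).le⟩) (hε n) ?_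
      intro x
      refine le_trans ?_ (le_abs_self _)
      simp only [_root_.add_apply, _root_.smul_apply, id_apply,
        inner_add_left, real_inner_smul_left, real_inner_self_eq_norm_sq]
      change ‖x‖ ^ 2 * (1 / ((n : ℝ) + 1)) ≤ _
      linarith [hpos x, mul_comm (‖x‖ ^ 2) (1 / ((n : ℝ) + 1))]
    obtain ⟨U, hU⟩ := hu
    refine ⟨(U⁻¹ : (V →L[ℝ] V)ˣ), fun x => ?_, fun x => ?_⟩
    · have := congrArg (fun F : V →L[ℝ] V => F x) U.inv_mul
      rw [hU] at this
      simpa using this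
    · have := congrArg (fun F : V →L[ℝ] V => F x) U.mul_inv
      rw [hU] at this
      simpa using this
  choose J hl hr using hinv
  have hsub : ∀ (n : ℕ) x, x - S (J n x) = (1 / ((n : ℝ) + 1)) • J n x := fun n x => by
    rw [sub_eq_iff_eq_add', hr]
  have hcomm : ∀ (n : ℕ) x, J n (S x) = S (J n x) := fun n x => by
    have h := hl n x
    rw [map_add, map_smul] at h
    rw [eq_sub_of_add_eq h, ← hsub, sub_sub_cancel]
  have hJpos : ∀ (n : ℕ) x, (1 / ((n : ℝ) + 1)) * ‖J n x‖ ≤ ‖x‖ := by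
    intro n x
    have h1 : (1 / ((n : ℝ) + 1)) * ‖J n x‖ ^ 2 ≤ ‖x‖ * ‖J n x‖ := by
      calc (1 / ((n : ℝ) + 1)) * ‖J n x‖ ^ 2
          ≤ ⟪S (J n x) + (1 / ((n : ℝ) + 1)) • J n x, J n x⟫ := by
            rw [inner_add_left, real_inner_smul_left, real_inner_self_eq_norm_sq]
            linarith [hpos (J n x)]
        _ ≤ ‖x‖ * ‖J n x‖ := by rw [hr]; exact real_inner_le_norm _ _
    rcases (norm_nonneg (J n x)).eq_or_lt with h0 | h0
    · rw [← h0, mul_zero]; exact norm_nonneg x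
    · refine le_of_mul_le_mul_right ?_ h0
      linarith [h1, sq (‖J n x‖)]
  have hbd : ∀ n x, ‖x - S (J n x)‖ ≤ ‖x‖ := fun n x => by
    rw [hsub, norm_smul, Real.norm_of_nonneg (hε n).le]
    exact hJpos n x
  refine ⟨J, hcomm, fun n x y => ?_, hbd, fun x => ?_⟩
  · conv_lhs => rw [← hr n y]
    conv_rhs => rw [← hr n x]
    simp only [inner_add_left, inner_add_right, real_inner_smul_left, real_inner_smul_right, hsymm]
  · -- On the range of `S` the remainder is `O(ε)`; that range is dense and the remainders are
    -- equibounded.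
    have hdense : Dense (LinearMap.range S.toLinearMap : Set V) := by
      rw [Submodule.dense_iff_topologicalClosure_eq_top, Submodule.topologicalClosure_eq_top_iff,
        Submodule.eq_bot_iff]
      intro y hy
      refine hinj ?_
      rw [map_zero, ← inner_self_eq_zero (𝕜 := ℝ), ← hsymm]
      exact (Submodule.mem_orthogonal _ _).1 hy _ ⟨S y, rfl⟩
    rw [Metric.tendsto_atTop]
    intro δ hδ
    obtain ⟨-, ⟨z, rfl⟩, hz⟩ := Metric.mem_closure_iff.1 (hdense x) (δ / 2) (half_pos hδ)
    obtain ⟨N, hN⟩ := (Metric.tendsto_atTop.1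
      ((tendsto_one_div_add_atTop_nhds_zero_nat (𝕜 := ℝ)).mul_const (2 * ‖z‖))) (δ / 2)
        (half_pos hδ)
    refine ⟨N, fun n hn => ?_⟩
    have hzn : ‖S z - S (J n (S z))‖ ≤ 1 / ((n : ℝ) + 1) * (2 * ‖z‖) := by
      rw [hsub, norm_smul, Real.norm_of_nonneg (hε n).le, hcomm]
      refine mul_le_mul_of_nonneg_left ?_ (hε n).le
      calc ‖S (J n z)‖ = ‖z - (z - S (J n z))‖ := by rw [sub_sub_cancel]
        _ ≤ ‖z‖ + ‖z - S (J n z)‖ := norm_sub_le _ _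
        _ ≤ 2 * ‖z‖ := by linarith [hbd n z]
    have h2 := hN n hn
    rw [zero_mul, Real.dist_0_eq_abs] at h2
    rw [dist_zero_right]
    calc ‖x - S (J n x)‖ = ‖((x - S z) - S (J n (x - S z))) + (S z - S (J n (S z)))‖ := by
          simp only [map_sub]; congr 1; abel
      _ ≤ ‖(x - S z) - S (J n (x - S z))‖ + ‖S z - S (J n (S z))‖ := norm_add_le _ _
      _ < δ / 2 + δ / 2 := by
        refine add_lt_add ((hbd n _).trans_lt ?_) (hzn.trans_lt (lt_of_abs_lt h2))
        rwa [← dist_eq_norm]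
      _ = δ := add_halves δ

end Resolvent

/-! ### The trace theorem -/

section Trace

open ContinuousLinearMap Filter Topology
open scoped InnerProduct

variable {H : Type*} [NormedAddCommGroup H] [InnerProductSpace ℝ H] [CompleteSpace H]
  {V : Type*} [NormedAddCommGroup V] [InnerProductSpace ℝ V] [CompleteSpace V]

theorem intervalIntegrable_of_memLp_two {E : Type*} [NormedAddCommGroup E] {T : ℝ} (hT : 0 ≤ T)
    {q : ℝ → E} (hq : MemLp q 2 ((volume : Measure ℝ).restrict (Ioo 0 T))) :
    IntervalIntegrable q volume 0 T := by
  rw [intervalIntegrable_iff_integrableOn_Ioc_of_le hT, integrableOn_Ioc_iff_integrableOn_Ioo]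
  exact hq.integrable (by norm_num)

/-- If `ι† ι u` is almost everywhere the primitive `c + ∫ q` and `D` is symmetric and commutes with
`ι† ι`, then `ι D (c + ∫ q)` is an `H`-valued primitive. The change of its energy is expressed by
`q` and `u`, without the primitive. -/
theorem energy_of_commuting (ι : V →L[ℝ] H) {T : ℝ} (hT : 0 ≤ T) {u q : ℝ → V}
    (hq : IntervalIntegrable q volume 0 T) {c : V}
    (h : ∀ᵐ t ∂(volume : Measure ℝ).restrict (Ioo 0 T), (ι†) (ι (u t)) = c + ∫ s in 0..t, q s)
    (D : V →L[ℝ] V) (hcomm : ∀ x, D ((ι†) (ι x)) = (ι†) (ι (D x)))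
    (hsymm : ∀ x y, ⟪D x, y⟫ = ⟪x, D y⟫) {t : ℝ} (ht : t ∈ Icc 0 T) :
    ‖ι (D (c + ∫ s in 0..t, q s))‖ ^ 2 - ‖ι (D c)‖ ^ 2
      = 2 * ∫ s in 0..t, ⟪q s, (ι†) (ι (D ((ι†) (ι (D (u s))))))⟫ := by
  have hqt : ∀ r ∈ Icc 0 T, IntervalIntegrable q volume 0 r := fun r hr =>
    hq.mono_set (by rw [uIcc_of_le hr.1, uIcc_of_le hT]; exact Icc_subset_Icc_right hr.2)
  have hmap : ∀ r ∈ Icc 0 T,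
      ι (D (c + ∫ s in 0..r, q s)) = ι (D c) + ∫ s in 0..r, (ι ∘L D) (q s) := fun r hr => by
    rw [ContinuousLinearMap.intervalIntegral_comp_comm _ (hqt r hr)]
    simp
  have hE := two_mul_integral_inner_primitive ht.1
    ⟨(ι ∘L D).integrable_comp (hqt t ht).1, (ι ∘L D).integrable_comp (hqt t ht).2⟩ (ι (D c))
  rw [hmap t ht, ← hE]
  congr 1
  rw [intervalIntegral.integral_of_le ht.1, intervalIntegral.integral_of_le ht.1,
    integral_Ioc_eq_integral_Ioo, integral_Ioc_eq_integral_Ioo]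
  refine integral_congr_ae ?_
  filter_upwards [ae_restrict_of_ae_restrict_of_subset (Ioo_subset_Ioo_right ht.2) h,
    ae_restrict_mem measurableSet_Ioo] with s hs hs'
  rw [← hmap s ⟨hs'.1.le, hs'.2.le.trans ht.2⟩, ← hs]
  simp only [coe_comp, Function.comp_apply]
  rw [← adjoint_inner_right, hsymm]
  simp only [hcomm]

/-- The embedding `L²(0,T;V) ∩ H¹(0,T;V') ⊂ C([0,T];H)` with its energy identity, for functions
given in integrated form. The representative is the uniform limit of the regularized functions
`ι J n (c + ∫ q)`, which are uniformly Cauchy in `H` by the energy identity for differences. -/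
theorem exists_continuous_representative (ι : V →L[ℝ] H) (hι : Function.Injective ι) {T : ℝ}
    (hT : 0 < T) {u q : ℝ → V} (hu : MemLp u 2 ((volume : Measure ℝ).restrict (Ioo 0 T)))
    (hq : MemLp q 2 ((volume : Measure ℝ).restrict (Ioo 0 T))) {c : V}
    (h : ∀ᵐ t ∂(volume : Measure ℝ).restrict (Ioo 0 T), (ι†) (ι (u t)) = c + ∫ s in 0..t, q s) :
    ∃ W : ℝ → H, ContinuousOn W (Icc 0 T) ∧
      (∀ᵐ t ∂(volume : Measure ℝ).restrict (Ioo 0 T), W t = ι (u t)) ∧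
      (∀ t ∈ Icc 0 T, (ι†) (W t) = c + ∫ s in 0..t, q s) ∧
      ‖W T‖ ^ 2 - ‖W 0‖ ^ 2 = 2 * ∫ t in Ioo 0 T, ⟪q t, u t⟫ := by
  set μ := (volume : Measure ℝ).restrict (Ioo 0 T) with hμ
  have hqi := intervalIntegrable_of_memLp_two hT.le hq
  have hSinj : Function.Injective (ι† ∘L ι) := by
    refine (injective_iff_map_eq_zero _).2 fun x hx => hι ?_
    have : ⟪(ι†) (ι x), x⟫ = 0 := by
      rw [show (ι†) (ι x) = 0 from hx, inner_zero_left]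
    rw [adjoint_inner_left, inner_self_eq_zero] at this
    rw [this, map_zero]
  obtain ⟨J, hcomm, hsymm, hbd, hlim⟩ := exists_approx_inverse (ι† ∘L ι)
    (fun x y => by simp [adjoint_inner_left, adjoint_inner_right])
    (fun x => by simp [adjoint_inner_left]) hSinj
  simp only [coe_comp, Function.comp_apply] at hcomm hbd hlim
  set G : ℝ → V := fun t => c + ∫ s in 0..t, q s with hG
  have hGcont : ContinuousOn G (Icc 0 T) := continuousOn_const_add_integral hT.le hqi c
  -- `P n = ι† ι J n` is bounded by `2` uniformly in `n`.
  have hP : ∀ n x, ‖(ι†) (ι (J n x))‖ ≤ 2 * ‖x‖ := fun n x => by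
    calc ‖(ι†) (ι (J n x))‖ = ‖x - (x - (ι†) (ι (J n x)))‖ := by rw [sub_sub_cancel]
      _ ≤ ‖x‖ + ‖x - (ι†) (ι (J n x))‖ := norm_sub_le _ _
      _ ≤ 2 * ‖x‖ := by linarith [hbd n x]
  have hPP : ∀ n m x, ‖(ι†) (ι ((J n - J m) ((ι†) (ι ((J n - J m) x)))))‖
      ≤ 4 * (‖x - (ι†) (ι (J n x))‖ + ‖x - (ι†) (ι (J m x))‖) := by
    intro n m x
    have h1 : ∀ y, ‖(ι†) (ι ((J n - J m) y))‖ ≤ 4 * ‖y‖ := fun y => by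
      simp only [_root_.sub_apply, map_sub]
      exact (norm_sub_le _ _).trans (by linarith [hP n y, hP m y])
    refine (h1 _).trans (mul_le_mul_of_nonneg_left ?_ (by norm_num))
    rw [show (ι†) (ι ((J n - J m) x)) = (x - (ι†) (ι (J m x))) - (x - (ι†) (ι (J n x))) by
      simp only [_root_.sub_apply, map_sub]; abel, add_comm]
    exact norm_sub_le _ _
  have hqu : Integrable (fun t => ‖q t‖ * ‖u t‖) μ := hq.norm.integrable_mul hu.norm
  have hcl : ∀ F : V →L[ℝ] V, AEStronglyMeasurable (fun t => F (u t)) μ := fun F =>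
    F.continuous.comp_aestronglyMeasurable hu.1
  have hrm : ∀ n, AEStronglyMeasurable (fun t => u t - (ι†) (ι (J n (u t)))) μ := fun n =>
    hu.1.sub (hcl (ι† ∘L ι ∘L J n))
  have hqr : ∀ n, Integrable (fun t => ‖q t‖ * ‖u t - (ι†) (ι (J n (u t)))‖) μ := fun n =>
    hqu.mono' (hq.1.norm.mul (hrm n).norm) (Eventually.of_forall fun t => by
      rw [Real.norm_of_nonneg (by positivity)]
      exact mul_le_mul_of_nonneg_left (hbd n _) (norm_nonneg _))
  set a : ℕ → ℝ := fun n => ∫ t, ‖q t‖ * ‖u t - (ι†) (ι (J n (u t)))‖ ∂μ with ha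
  have ha0 : Tendsto a atTop (𝓝 0) := by
    have := tendsto_integral_of_dominated_convergence (μ := μ)
      (F := fun n t => ‖q t‖ * ‖u t - (ι†) (ι (J n (u t)))‖) (f := fun _ => 0)
      (fun t => ‖q t‖ * ‖u t‖) (fun n => (hqr n).1) hqu
      (fun n => Eventually.of_forall fun t => by
        rw [Real.norm_of_nonneg (by positivity)]
        exact mul_le_mul_of_nonneg_left (hbd n _) (norm_nonneg _))
      (Eventually.of_forall fun t => by
        simpa using (hlim (u t)).norm.const_mul ‖q t‖)
    simpa using this
  -- The energy of the difference of two regularizations.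
  have hdiff : ∀ n m, ∀ t ∈ Icc 0 T,
      |‖ι ((J n - J m) (G t))‖ ^ 2 - ‖ι ((J n - J m) c)‖ ^ 2| ≤ 8 * (a n + a m) := by
    intro n m t ht
    rw [energy_of_commuting ι hT.le hqi h (J n - J m)
      (fun x => by simp only [_root_.sub_apply, hcomm, map_sub])
      (fun x y => by simp only [_root_.sub_apply, inner_sub_left, inner_sub_right, hsymm]) ht,
      abs_mul, abs_two, intervalIntegral.integral_of_le ht.1, integral_Ioc_eq_integral_Ioo,
      ← integral_add (hqr n) (hqr m)]
    have hint : Integrable (fun t => 4 * (‖q t‖ * ‖u t - (ι†) (ι (J n (u t)))‖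
        + ‖q t‖ * ‖u t - (ι†) (ι (J m (u t)))‖)) μ := ((hqr n).add (hqr m)).const_mul 4
    have hle : ‖∫ s in Ioo 0 t, ⟪q s, (ι†) (ι ((J n - J m) ((ι†) (ι ((J n - J m) (u s))))))⟫‖
        ≤ ∫ s in Ioo 0 t, 4 * (‖q s‖ * ‖u s - (ι†) (ι (J n (u s)))‖
        + ‖q s‖ * ‖u s - (ι†) (ι (J m (u s)))‖) := by
      refine norm_integral_le_of_norm_le (hint.mono_measure
        (Measure.restrict_mono (Ioo_subset_Ioo_right ht.2) le_rfl))
        (Eventually.of_forall fun s => (norm_inner_le_norm _ _).trans ?_)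
      refine (mul_le_mul_of_nonneg_left (hPP n m (u s)) (norm_nonneg _)).trans (le_of_eq ?_)
      ring
    have hmono : ∫ s in Ioo 0 t, 4 * (‖q s‖ * ‖u s - (ι†) (ι (J n (u s)))‖
        + ‖q s‖ * ‖u s - (ι†) (ι (J m (u s)))‖) ≤ ∫ s, 4 * (‖q s‖ * ‖u s - (ι†) (ι (J n (u s)))‖
        + ‖q s‖ * ‖u s - (ι†) (ι (J m (u s)))‖) ∂μ :=
      setIntegral_mono_set hint (Eventually.of_forall fun s => by positivity)
        (Ioo_subset_Ioo_right ht.2).eventuallyLE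
    rw [integral_const_mul, integral_const_mul] at hmono
    rw [Real.norm_eq_abs, integral_const_mul] at hle
    linarith
  -- A time at which the equation for `u` holds pointwise.
  obtain ⟨s₀, hs₀, hs₀T⟩ : ∃ s, (ι†) (ι (u s)) = G s ∧ s ∈ Ioo 0 T := by
    have : (ae μ).NeBot := by
      rw [ae_neBot, hμ, Ne, Measure.restrict_eq_zero, Real.volume_Ioo]
      simpa using hT
    exact (h.and (ae_restrict_mem measurableSet_Ioo)).exists
  set b : ℕ → ℝ := fun n => ‖ι‖ * ‖u s₀ - (ι†) (ι (J n (u s₀)))‖ with hb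
  have hb0 : Tendsto b atTop (𝓝 0) := by
    simpa using (hlim (u s₀)).norm.const_mul ‖ι‖
  have hbs : ∀ n m, ‖ι ((J n - J m) (G s₀))‖ ≤ b n + b m := by
    intro n m
    rw [← hs₀, show (J n - J m) ((ι†) (ι (u s₀)))
      = (u s₀ - (ι†) (ι (J m (u s₀)))) - (u s₀ - (ι†) (ι (J n (u s₀)))) by
        simp only [_root_.sub_apply, hcomm]; abel]
    refine (ι.le_opNorm _).trans ?_
    rw [hb, ← mul_add, add_comm]
    exact mul_le_mul_of_nonneg_left (norm_sub_le _ _) (norm_nonneg _)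
  have hcauchy : UniformCauchySeqOn (fun n t => ι (J n (G t))) atTop (Icc 0 T) := by
    rw [Metric.uniformCauchySeqOn_iff]
    intro ε hε
    obtain ⟨N, hN⟩ := eventually_atTop.1 ((ha0.eventually_lt_const
      (show (0 : ℝ) < ε ^ 2 / 64 by positivity)).and (hb0.eventually_lt_const
      (show (0 : ℝ) < ε / 4 by positivity)))
    refine ⟨N, fun n hn m hm t ht => ?_⟩
    have h1 := (abs_le.1 (hdiff n m t ht)).2
    have h2 := (abs_le.1 (hdiff n m s₀ ⟨hs₀T.1.le, hs₀T.2.le⟩)).1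
    have h3 : ‖ι ((J n - J m) (G s₀))‖ ^ 2 ≤ (b n + b m) ^ 2 :=
      pow_le_pow_left₀ (norm_nonneg _) (hbs n m) 2
    have h4 : (b n + b m) ^ 2 ≤ (ε / 2) ^ 2 :=
      pow_le_pow_left₀ ((norm_nonneg _).trans (hbs n m))
        (by linarith [(hN n hn).2, (hN m hm).2]) 2
    have h5 : ‖ι ((J n - J m) (G t))‖ ^ 2 < ε ^ 2 := by
      have := (hN n hn).1
      have := (hN m hm).1
      nlinarith [sq_pos_of_pos hε]
    rw [dist_eq_norm, ← map_sub, ← _root_.sub_apply]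
    exact lt_of_pow_lt_pow_left₀ 2 hε.le h5
  have hptw : ∀ t ∈ Icc 0 T, ∃ w, Tendsto (fun n => ι (J n (G t))) atTop (𝓝 w) := fun t ht =>
    cauchySeq_tendsto_of_complete (hcauchy.cauchySeq ht)
  choose! W hW using hptw
  have hunif := hcauchy.tendstoUniformlyOn_of_tendsto hW
  refine ⟨W, hunif.continuousOn (Frequently.of_forall fun n =>
    (ι ∘L J n).continuous.comp_continuousOn hGcont), ?_, ?_, ?_⟩
  · filter_upwards [h, ae_restrict_mem measurableSet_Ioo] with t ht htT
    refine tendsto_nhds_unique (hW t ⟨htT.1.le, htT.2.le⟩) ?_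
    have h1 : Tendsto (fun n => u t - (u t - (ι†) (ι (J n (u t))))) atTop (𝓝 (u t - 0)) :=
      tendsto_const_nhds.sub (hlim (u t))
    simp only [sub_sub_cancel, sub_zero, ← hcomm] at h1
    simp only [hG, ← ht]
    exact (ι.continuous.tendsto _).comp h1
  · intro t ht
    refine tendsto_nhds_unique (((ι†).continuous.tendsto _).comp (hW t ht)) ?_
    have h1 : Tendsto (fun n => G t - (G t - (ι†) (ι (J n (G t))))) atTop (𝓝 (G t - 0)) :=
      tendsto_const_nhds.sub (hlim (G t))
    simp only [sub_sub_cancel, sub_zero] at h1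
    exact h1
  · have hT' : T ∈ Icc 0 T := ⟨hT.le, le_rfl⟩
    have h0' : (0 : ℝ) ∈ Icc 0 T := ⟨le_rfl, hT.le⟩
    have hG0 : G 0 = c := by simp [hG]
    have hL := ((hW T hT').norm.pow 2).sub ((hW 0 h0').norm.pow 2)
    simp only [hG0] at hL
    have hEn := fun n => energy_of_commuting ι hT.le hqi h (J n) (hcomm n) (hsymm n) hT'
    simp only [intervalIntegral.integral_of_le hT.le, integral_Ioc_eq_integral_Ioo] at hEn
    simp only [hG, intervalIntegral.integral_of_le hT.le, integral_Ioc_eq_integral_Ioo, hEn] at hL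
    refine tendsto_nhds_unique hL (Tendsto.const_mul 2 ?_)
    refine tendsto_integral_of_dominated_convergence (fun t => 4 * (‖q t‖ * ‖u t‖))
      (fun n => hq.1.inner (hcl (ι† ∘L ι ∘L J n ∘L ι† ∘L ι ∘L J n))) (hqu.const_mul 4)
      (fun n => Eventually.of_forall fun t => ?_) (Eventually.of_forall fun t => ?_)
    · refine (norm_inner_le_norm _ _).trans ?_
      have := mul_le_mul_of_nonneg_left
        ((hP n ((ι†) (ι (J n (u t))))).trans (mul_le_mul_of_nonneg_left (hP n (u t)) zero_le_two))
        (norm_nonneg (q t))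
      linarith
    · refine Tendsto.inner tendsto_const_nhds ?_
      -- `P n (P n x) - x = -(P n (x - P n x)) - (x - P n x)`.
      rw [tendsto_iff_norm_sub_tendsto_zero]
      refine squeeze_zero (fun _ => norm_nonneg _) (fun n => ?_)
        (by simpa using (hlim (u t)).norm.const_mul 3)
      set x := u t
      rw [show (ι†) (ι (J n ((ι†) (ι (J n x))))) - x
        = -((ι†) (ι (J n (x - (ι†) (ι (J n x))))) + (x - (ι†) (ι (J n x)))) by
          simp only [map_sub]; abel, norm_neg]
      exact (norm_add_le _ _).trans (by linarith [hP n (x - (ι†) (ι (J n x)))])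

end Trace
/-! ### Weak derivatives and primitives -/

section WeakDerivative

open ContinuousLinearMap Filter Topology
open scoped InnerProduct

theorem integrableOn_smul_of_continuous {E : Type*} [NormedAddCommGroup E] [NormedSpace ℝ E]
    {φ : ℝ → ℝ} (hφ : Continuous φ) (hc : HasCompactSupport φ) {s : Set ℝ} {g : ℝ → E}
    (hg : IntegrableOn g s) : IntegrableOn (fun t => φ t • g t) s := by
  obtain ⟨K, hK⟩ := hc.exists_bound_of_continuous hφ
  exact hg.bdd_smul K hφ.aestronglyMeasurable (Filter.Eventually.of_forall hK)

/-- The primitive of a test function with vanishing integral is a test function. -/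
theorem exists_testFunction_deriv_eq {T : ℝ} {ψ : ℝ → ℝ} (hψ : ContDiff ℝ ∞ ψ)
    (hc : HasCompactSupport ψ) (hs : tsupport ψ ⊆ Ioo 0 T) (h0 : ∫ t, ψ t = 0) :
    ∃ θ : ℝ → ℝ, ContDiff ℝ ∞ θ ∧ HasCompactSupport θ ∧ tsupport θ ⊆ Ioo 0 T ∧ deriv θ = ψ := by
  rcases (tsupport ψ).eq_empty_or_nonempty with he | hne
  · refine ⟨0, contDiff_const, HasCompactSupport.zero, by simp [tsupport], ?_⟩
    rw [tsupport_eq_empty_iff.1 he]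
    ext t; simp
  obtain ⟨a, haK, ha⟩ := hc.isCompact.exists_isLeast hne
  obtain ⟨b, hbK, hb⟩ := hc.isCompact.exists_isGreatest hne
  have hd : deriv (fun t => ∫ s in 0..t, ψ s) = ψ := by
    ext t
    exact hψ.continuous.deriv_integral ψ 0 t
  have hsup : tsupport (fun t => ∫ s in 0..t, ψ s) ⊆ Icc a b := by
    refine closure_minimal (fun t ht => ?_) isClosed_Icc
    by_contra hcon
    refine ht ?_
    rw [mem_Icc, not_and_or, not_le, not_le] at hcon
    rcases hcon with hlt | hlt
    · refine (intervalIntegral.integral_congr (g := fun _ => (0 : ℝ)) fun s hs' => ?_).trans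
        intervalIntegral.integral_zero
      refine image_eq_zero_of_notMem_tsupport fun hsK => ?_
      exact absurd ((ha hsK).trans hs'.2) (not_le.2 (max_lt (hs haK).1 hlt))
    · change ∫ s in 0..t, ψ s = 0
      rw [intervalIntegral.integral_eq_integral_of_support_subset, h0]
      intro s hsψ
      have := subset_tsupport _ hsψ
      exact ⟨(hs this).1, (hb this).trans hlt.le⟩
  refine ⟨_, ?_, isCompact_Icc.of_isClosed_subset (isClosed_tsupport _) hsup,
    hsup.trans fun t ht => ⟨(hs haK).1.trans_le ht.1, ht.2.trans_lt (hs hbK).2⟩, hd⟩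
  rw [contDiff_infty_iff_deriv, hd]
  exact ⟨fun t => (intervalIntegral.integral_hasDerivAt_right
    (hψ.continuous.intervalIntegrable _ _)
    hψ.continuous.aestronglyMeasurable.stronglyMeasurableAtFilter
    hψ.continuous.continuousAt).differentiableAt, hψ⟩

/-- **Du Bois-Reymond lemma**: a function on `(0, T)` with vanishing weak derivative is constant. -/
theorem exists_ae_eq_const_of_integral_deriv_smul_eq_zero {E : Type*} [NormedAddCommGroup E]
    [NormedSpace ℝ E] [CompleteSpace E] {T : ℝ} (hT : 0 < T) {d : ℝ → E}
    (hd : IntegrableOn d (Ioo 0 T))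
    (h : ∀ φ : ℝ → ℝ, ContDiff ℝ ∞ φ → HasCompactSupport φ → tsupport φ ⊆ Ioo 0 T →
      ∫ t in Ioo 0 T, deriv φ t • d t = 0) :
    ∃ c : E, ∀ᵐ t ∂(volume : Measure ℝ).restrict (Ioo 0 T), d t = c := by
  obtain ⟨φ₀, hφ₀d, hφ₀c, hφ₀s, hφ₀i⟩ : ∃ φ₀ : ℝ → ℝ, ContDiff ℝ ∞ φ₀ ∧ HasCompactSupport φ₀ ∧
      tsupport φ₀ ⊆ Ioo 0 T ∧ ∫ t, φ₀ t = 1 := by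
    let β : ContDiffBump (T / 2) := ⟨T / 8, T / 4, by positivity, by linarith⟩
    refine ⟨β.normed volume, β.contDiff_normed, β.hasCompactSupport_normed, ?_, β.integral_normed⟩
    rw [β.tsupport_normed_eq, Real.closedBall_eq_Icc]
    exact Icc_subset_Ioo (by change 0 < T / 2 - T / 4; linarith)
      (by change T / 2 + T / 4 < T; linarith)
  set c := ∫ t in Ioo 0 T, φ₀ t • d t
  refine ⟨c, ?_⟩
  have key : ∀ᵐ t, t ∈ Ioo 0 T → d t - c = 0 := by
    refine isOpen_Ioo.ae_eq_zero_of_integral_contDiff_smul_eq_zero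
      (f := fun t => d t - c) ?_ ?_
    · exact (hd.sub (integrableOn_const (by simp))).locallyIntegrableOn
    intro φ hφ hc hs
    have hfull : ∫ t in Ioo 0 T, φ t = ∫ t, φ t :=
      setIntegral_eq_integral_of_forall_compl_eq_zero fun t ht =>
        image_eq_zero_of_notMem_tsupport fun h => ht (hs h)
    -- Subtracting a multiple of `φ₀` makes the integral of `φ` vanish.
    set m := ∫ t, φ t
    have hψs : tsupport (fun t => φ t - m • φ₀ t) ⊆ tsupport φ ∪ tsupport φ₀ :=
      (tsupport_sub φ (m • φ₀)).trans
        (union_subset_union_right _ (tsupport_smul_subset_right (fun _ => m) φ₀))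
    have hψc : HasCompactSupport (fun t => φ t - m • φ₀ t) :=
      (hc.isCompact.union hφ₀c.isCompact).of_isClosed_subset (isClosed_tsupport _) hψs
    have hψd : ContDiff ℝ ∞ (fun t => φ t - m • φ₀ t) := hφ.sub (hφ₀d.const_smul m)
    have hψ0 : ∫ t, (φ t - m • φ₀ t) = 0 := by
      rw [integral_sub (g := fun t => m • φ₀ t) (hφ.continuous.integrable_of_hasCompactSupport hc)
        ((hφ₀d.continuous.integrable_of_hasCompactSupport hφ₀c).smul m), integral_smul,
        hφ₀i, smul_eq_mul, mul_one, sub_self]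
    obtain ⟨θ, hθ, hθc, hθs, hθd⟩ :=
      exists_testFunction_deriv_eq hψd hψc (hψs.trans (union_subset hs hφ₀s)) hψ0
    have h1 := h θ hθ hθc hθs
    have hi := integrableOn_smul_of_continuous hφ.continuous hc hd
    have hi₀ := integrableOn_smul_of_continuous hφ₀d.continuous hφ₀c hd
    rw [hθd] at h1
    simp only [sub_smul, smul_assoc] at h1
    rw [integral_sub (g := fun t => m • φ₀ t • d t) hi (hi₀.smul m), integral_smul,
      sub_eq_zero] at h1
    rw [← setIntegral_eq_integral_of_forall_compl_eq_zero (s := Ioo 0 T) fun t ht => by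
      rw [image_eq_zero_of_notMem_tsupport (fun h => ht (hs h)), zero_smul]]
    simp only [smul_sub]
    rw [integral_sub hi (integrableOn_smul_of_continuous hφ.continuous hc
      (integrableOn_const (by simp))), h1, integral_smul_const, hfull, sub_self]
  rw [ae_restrict_iff' measurableSet_Ioo]
  filter_upwards [key] with t ht htT
  exact sub_eq_zero.1 (ht htT)

variable {V : Type*} [NormedAddCommGroup V] [InnerProductSpace ℝ V] [CompleteSpace V]

/-- A primitive of an integrable function has this function as its weak derivative. -/
theorem integral_deriv_smul_primitive {T : ℝ} (hT : 0 < T) {g : ℝ → V}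
    (hg : IntervalIntegrable g volume 0 T) (c : V) {φ : ℝ → ℝ} (hφ : ContDiff ℝ ∞ φ)
    (hc : HasCompactSupport φ) (hs : tsupport φ ⊆ Ioo 0 T) :
    ∫ t in Ioo 0 T, deriv φ t • (c + ∫ s in 0..t, g s) = -∫ t in Ioo 0 T, φ t • g t := by
  have hd : Continuous (deriv φ) := hφ.continuous_deriv (by simp)
  have hφT : φ T = 0 := image_eq_zero_of_notMem_tsupport fun h => (lt_irrefl _ (hs h).2)
  have hφ0 : φ 0 = 0 := image_eq_zero_of_notMem_tsupport fun h => (lt_irrefl _ (hs h).1)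
  have hFTC : ∀ t r, ∫ s in t..r, deriv φ s = φ r - φ t := fun t r =>
    intervalIntegral.integral_deriv_eq_sub (fun x _ => hφ.differentiable (by simp) x)
      (hd.intervalIntegrable _ _)
  have hG : ContinuousOn (fun t => c + ∫ s in 0..t, g s) (Icc 0 T) :=
    continuousOn_const_add_integral hT.le hg c
  have hG0 : ContinuousOn (fun t => ∫ s in 0..t, g s) (Icc 0 T) := by
    simpa using continuousOn_const_add_integral hT.le hg 0
  have hI : ∀ {x : ℝ → V}, ContinuousOn x (Icc 0 T) →
      IntegrableOn (fun t => deriv φ t • x t) (Ioc 0 T) := fun hx =>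
    ((hd.continuousOn.smul hx).integrableOn_Icc).mono_set Ioc_subset_Icc_self
  have hφg : IntegrableOn (fun t => φ t • g t) (Ioc 0 T) :=
    integrableOn_smul_of_continuous hφ.continuous hc
      ((intervalIntegrable_iff_integrableOn_Ioc_of_le hT.le).1 hg)
  rw [← integral_Ioc_eq_integral_Ioo, ← integral_Ioc_eq_integral_Ioo]
  simp only [smul_add]
  rw [integral_add (hI continuousOn_const) (hI hG0), integral_smul_const,
    ← intervalIntegral.integral_of_le hT.le, hFTC, hφT, hφ0, sub_zero, zero_smul, zero_add]
  refine ext_inner_right ℝ fun w => ?_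
  have h := integral_inner_integral_right_swap hT.le hg
    (p := fun s => deriv φ s • w) ((hd.smul continuous_const).intervalIntegrable _ _)
  simp only [intervalIntegral.integral_smul_const, hFTC, hφT, zero_sub, inner_smul_right,
    intervalIntegral.integral_of_le hT.le, neg_smul, inner_neg_right] at h
  rw [inner_neg_left, real_inner_comm, ← integral_inner (hI hG0), real_inner_comm,
    ← integral_inner hφg, ← integral_neg]
  simp only [real_inner_comm _ w, real_inner_smul_left]
  exact h.symm

/-- The Riesz isomorphism `V' → V` of a real Hilbert space, as a linear isometry. -/
noncomputable def riesz : StrongDual ℝ V ≃ₗᵢ[ℝ] V where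
  toFun := (InnerProductSpace.toDual ℝ V).symm
  invFun := InnerProductSpace.toDual ℝ V
  map_add' := by simp
  map_smul' := by simp
  left_inv := by intro x; simp
  right_inv := by intro x; simp
  norm_map' := by intro x; simp

theorem inner_riesz (f : StrongDual ℝ V) (v : V) : ⟪riesz f, v⟫ = f v :=
  InnerProductSpace.toDual_symm_apply

variable {H : Type*} [NormedAddCommGroup H] [InnerProductSpace ℝ H] [CompleteSpace H]

theorem riesz_embDual (ι : V →L[ℝ] H) (v : V) : riesz (embDual ι v) = (ι†) (ι v) :=
  ext_inner_right ℝ fun w => by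
    rw [inner_riesz, adjoint_inner_left]
    rfl

/-- `g` is the weak derivative of `u` if and only if `u`, regarded as a `V'`-valued function, is a
primitive of `g`. Here `V'` is identified with `V`, so that `V → V'` becomes `ι† ι`. -/
theorem hasWeakDeriv_iff_primitive (ι : V →L[ℝ] H) {T : ℝ} (hT : 0 < T) (u : L2 T V)
    (g : L2 T (StrongDual ℝ V)) :
    HasWeakDeriv ι T u g ↔ ∃ c : V, ∀ᵐ t ∂(volume : Measure ℝ).restrict (Ioo 0 T),
      (ι†) (ι (u t)) = c + ∫ s in 0..t, riesz (g s) := by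
  have hgr : MemLp (fun t => riesz (g t)) 2 ((volume : Measure ℝ).restrict (Ioo 0 T)) :=
    (riesz (V := V)).toContinuousLinearEquiv.toContinuousLinearMap.comp_memLp' (Lp.memLp g)
  have hgi := intervalIntegrable_of_memLp_two hT.le hgr
  have hSu : IntegrableOn (fun t => (ι†) (ι (u t))) (Ioo 0 T) :=
    ((ι† ∘L ι).comp_memLp' (Lp.memLp u)).integrable (by norm_num)
  have hweak : HasWeakDeriv ι T u g ↔
      ∀ φ : ℝ → ℝ, ContDiff ℝ ∞ φ → HasCompactSupport φ → tsupport φ ⊆ Ioo 0 T →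
        ∫ t in Ioo 0 T, deriv φ t • (ι†) (ι (u t)) = -∫ t in Ioo 0 T, φ t • riesz (g t) := by
    refine forall_congr' fun φ => forall_congr' fun _ => forall_congr' fun _ =>
      forall_congr' fun _ => ?_
    rw [← (riesz (V := V)).injective.eq_iff, map_neg]
    have hcomm : ∀ F : ℝ → StrongDual ℝ V,
        riesz (∫ t in Ioo 0 T, F t) = ∫ t in Ioo 0 T, riesz (F t) := fun F =>
      ((riesz (V := V)).toContinuousLinearEquiv.integral_comp_comm F).symm
    rw [hcomm, hcomm]
    simp only [map_smul, riesz_embDual]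
  rw [hweak]
  constructor
  · intro h
    have hG : IntegrableOn (fun t => ∫ s in 0..t, riesz (g s)) (Ioo 0 T) := by
      have := (continuousOn_const_add_integral hT.le hgi 0).integrableOn_Icc (μ := volume)
      simp only [zero_add] at this
      exact this.mono_set Ioo_subset_Icc_self
    obtain ⟨c, hc⟩ := exists_ae_eq_const_of_integral_deriv_smul_eq_zero hT (hSu.sub hG)
      (fun φ hφ hφc hφs => by
        have hd : Continuous (deriv φ) := hφ.continuous_deriv (by simp)
        have h2 := integral_deriv_smul_primitive hT hgi 0 hφ hφc hφs
        simp only [zero_add] at h2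
        simp only [Pi.sub_apply, smul_sub]
        rw [integral_sub (integrableOn_smul_of_continuous hd hφc.deriv hSu)
          (integrableOn_smul_of_continuous hd hφc.deriv hG), h φ hφ hφc hφs, h2, sub_self])
    exact ⟨c, hc.mono fun t ht => eq_add_of_sub_eq ht⟩
  · rintro ⟨c, hc⟩ φ hφ hφc hφs
    rw [← integral_deriv_smul_primitive hT hgi c hφ hφc hφs]
    refine integral_congr_ae ?_
    filter_upwards [hc] with t ht
    rw [ht]

end WeakDerivative
/-! ### Measurable families of bounded bilinear forms -/

section Form

open Filter Topology

variable {V : Type*} [NormedAddCommGroup V] [InnerProductSpace ℝ V]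

theorem aemeasurable_apply_simpleFunc {X Ω : Type*} [MeasurableSpace Ω] {μ : Measure Ω}
    {F : X → Ω → ℝ} (hF : ∀ x, AEMeasurable (F x) μ) (p : SimpleFunc Ω X) :
    AEMeasurable (fun t => F (p t) t) μ := by
  have : (fun t => F (p t) t) = fun t => ∑ x ∈ p.range, (p ⁻¹' {x}).indicator (F x) t := by
    ext t
    rw [Finset.sum_eq_single (p t)]
    · simp
    · intro x _ hx
      exact indicator_of_notMem (fun h => hx h.symm) _
    · intro h
      exact absurd (p.mem_range_self t) h
  rw [this]
  exact Finset.aemeasurable_fun_sum _ fun x _ => (hF x).indicator (p.measurableSet_preimage {x})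

theorem abs_le_of_forall_le {M : ℝ} {B : V →ₗ[ℝ] StrongDual ℝ V}
    (h : ∀ w v : V, B w v ≤ M * ‖w‖ * ‖v‖) (w v : V) : |B w v| ≤ M * ‖w‖ * ‖v‖ := by
  refine abs_le'.2 ⟨h w v, ?_⟩
  simpa using h w (-v)

theorem aemeasurable_form {M : ℝ} {μ : Measure ℝ} {A : ℝ → V →ₗ[ℝ] StrongDual ℝ V} (hM : 0 ≤ M)
    (hmeas : ∀ w v : V, AEMeasurable (fun t => A t w v) μ)
    (hbd : ∀ᵐ t ∂μ, ∀ w v : V, A t w v ≤ M * ‖w‖ * ‖v‖) {w v : ℝ → V}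
    (hw : AEStronglyMeasurable w μ) (hv : AEStronglyMeasurable v μ) :
    AEMeasurable (fun t => A t (w t) (v t)) μ := by
  have hsw := hw.stronglyMeasurable_mk
  have hsv := hv.stronglyMeasurable_mk
  refine aemeasurable_of_tendsto_metrizable_ae atTop
    (f := fun n t => A t (hsw.approx n t) (hsv.approx n t)) (fun n => ?_) ?_
  · exact aemeasurable_apply_simpleFunc (F := fun (x : V × V) t => A t x.1 x.2)
      (fun x => hmeas x.1 x.2) ((hsw.approx n).pair (hsv.approx n))
  · filter_upwards [hbd, hw.ae_eq_mk, hv.ae_eq_mk] with t ht htw htv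
    rw [htw, htv]
    have hAt : ∀ x, ‖A t x‖ ≤ M * ‖x‖ := fun x =>
      ContinuousLinearMap.opNorm_le_bound _ (by positivity) (abs_le_of_forall_le ht x)
    have hcont : Continuous (A t) := ((A t).mkContinuous M hAt).continuous
    have hlim : Tendsto (fun n => A t (hsw.approx n t)) atTop (𝓝 (A t (hw.mk w t))) :=
      (hcont.tendsto _).comp (hsw.tendsto_approx t)
    exact (isBoundedBilinearMap_apply.continuous.tendsto (A t (hw.mk w t), hv.mk v t)).comp
      (hlim.prodMk_nhds (hsv.tendsto_approx t))

theorem integrable_form {M : ℝ} {μ : Measure ℝ} {A : ℝ → V →ₗ[ℝ] StrongDual ℝ V} (hM : 0 ≤ M)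
    (hmeas : ∀ w v : V, AEMeasurable (fun t => A t w v) μ)
    (hbd : ∀ᵐ t ∂μ, ∀ w v : V, A t w v ≤ M * ‖w‖ * ‖v‖) (w v : Lp V 2 μ) :
    Integrable (fun t => A t (w t) (v t)) μ := by
  refine (((Lp.memLp w).norm.integrable_mul (Lp.memLp v).norm).const_mul M).mono'
    (aemeasurable_form hM hmeas hbd (Lp.aestronglyMeasurable w)
      (Lp.aestronglyMeasurable v)).aestronglyMeasurable ?_
  filter_upwards [hbd] with t ht
  refine (abs_le_of_forall_le ht _ _).trans (le_of_eq ?_)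
  simp [mul_assoc]

theorem integral_norm_mul_norm_le {E : Type*} [NormedAddCommGroup E] {μ : Measure ℝ}
    (w v : Lp E 2 μ) :
    ∫ t, ‖w t‖ * ‖v t‖ ∂μ ≤ ‖w‖ * ‖v‖ := by
  have hn : ∀ x : Lp E 2 μ, ‖(Lp.memLp x).norm.toLp _‖ = ‖x‖ := fun x => by
    rw [Lp.norm_toLp, eLpNorm_norm, Lp.norm_def]
  have h := real_inner_le_norm ((Lp.memLp w).norm.toLp _) ((Lp.memLp v).norm.toLp _)
  rw [hn, hn, L2.inner_def] at h
  refine le_trans (le_of_eq (integral_congr_ae ?_)) h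
  filter_upwards [(Lp.memLp w).norm.coeFn_toLp, (Lp.memLp v).norm.coeFn_toLp] with t h1 h2
  rw [h1, h2]
  simp [mul_comm]

/-- The bounded operator on `L²(J; V)` which represents `∫ ⟨A(t) w, v⟩ dt`. It exists without any
strong measurability of `t ↦ A t (w t)`, which may fail if `V` is not separable. -/
theorem exists_form_operator [CompleteSpace V] {M α : ℝ} {μ : Measure ℝ}
    {A : ℝ → V →ₗ[ℝ] StrongDual ℝ V} (hM : 0 ≤ M)
    (hmeas : ∀ w v : V, AEMeasurable (fun t => A t w v) μ)
    (hbd : ∀ᵐ t ∂μ, ∀ w v : V, A t w v ≤ M * ‖w‖ * ‖v‖)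
    (hco : ∀ᵐ t ∂μ, ∀ v : V, α * ‖v‖ ^ 2 ≤ A t v v) :
    ∃ 𝒜 : Lp V 2 μ →L[ℝ] Lp V 2 μ,
      (∀ w v, ⟪𝒜 w, v⟫ = ∫ t, A t (w t) (v t) ∂μ) ∧ (∀ w, ‖𝒜 w‖ ≤ M * ‖w‖) ∧
      ∀ w, α * ‖w‖ ^ 2 ≤ ⟪𝒜 w, w⟫ := by
  have hint := integrable_form hM hmeas hbd
  let B₀ : Lp V 2 μ →ₗ[ℝ] Lp V 2 μ →ₗ[ℝ] ℝ :=
    LinearMap.mk₂ ℝ (fun w v => ∫ t, A t (w t) (v t) ∂μ)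
      (fun w w' v => by
        rw [← integral_add (hint w v) (hint w' v)]
        refine integral_congr_ae ?_
        filter_upwards [Lp.coeFn_add w w'] with t ht
        rw [ht, Pi.add_apply, map_add, _root_.add_apply])
      (fun r w v => by
        rw [← integral_smul]
        refine integral_congr_ae ?_
        filter_upwards [Lp.coeFn_smul r w] with t ht
        rw [ht, Pi.smul_apply, map_smul, _root_.smul_apply])
      (fun w v v' => by
        rw [← integral_add (hint w v) (hint w v')]
        refine integral_congr_ae ?_
        filter_upwards [Lp.coeFn_add v v'] with t ht
        rw [ht, Pi.add_apply, map_add])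
      (fun r w v => by
        rw [← integral_smul]
        refine integral_congr_ae ?_
        filter_upwards [Lp.coeFn_smul r v] with t ht
        rw [ht, Pi.smul_apply, map_smul])
  have hB₀ : ∀ w v, ‖B₀ w v‖ ≤ M * ‖w‖ * ‖v‖ := by
    intro w v
    have hi := (Lp.memLp w).norm.integrable_mul (Lp.memLp v).norm
    refine (norm_integral_le_of_norm_le (hi.const_mul M) ?_).trans ?_
    · filter_upwards [hbd] with t ht
      refine (abs_le_of_forall_le ht _ _).trans (le_of_eq ?_)
      simp [mul_assoc]
    · rw [integral_const_mul, mul_assoc]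
      exact mul_le_mul_of_nonneg_left (integral_norm_mul_norm_le w v) hM
  let B : Lp V 2 μ →L[ℝ] Lp V 2 μ →L[ℝ] ℝ := B₀.mkContinuous₂ M hB₀
  let 𝒜 := InnerProductSpace.continuousLinearMapOfBilin (𝕜 := ℝ) B
  have h𝒜 : ∀ w v, ⟪𝒜 w, v⟫ = B₀ w v := fun w v =>
    InnerProductSpace.continuousLinearMapOfBilin_apply (𝕜 := ℝ) B w v
  refine ⟨𝒜, h𝒜, fun w => ?_, fun w => ?_⟩
  · have h1 : ‖𝒜 w‖ * ‖𝒜 w‖ ≤ M * ‖w‖ * ‖𝒜 w‖ := by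
      rw [← real_inner_self_eq_norm_mul_norm, h𝒜]
      exact (le_abs_self _).trans (hB₀ w _)
    rcases (norm_nonneg (𝒜 w)).eq_or_lt with h0 | h0
    · rw [← h0]; positivity
    · exact le_of_mul_le_mul_right h1 h0
  · rw [← real_inner_self_eq_norm_sq, L2.inner_def, h𝒜, ← integral_const_mul]
    refine integral_mono_ae ((L2.integrable_inner w w).const_mul α) (hint w w) ?_
    filter_upwards [hco] with t ht
    simpa only [real_inner_self_eq_norm_sq] using ht (w t)

end Form

/-! ### Lions' projection argument -/

section Lions

open ContinuousLinearMap Filter Topology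
open scoped InnerProduct

/-- A linear functional `L` which is dominated by `B`, in the sense that `|L ψ| ≤ C ‖B ψ‖`, factors
through `B`, and the factor is represented by a vector of norm at most `C`. -/
theorem exists_inner_eq_of_abs_le {F Ψ : Type*} [NormedAddCommGroup F] [InnerProductSpace ℝ F]
    [CompleteSpace F] [AddCommGroup Ψ] [Module ℝ Ψ] (B : Ψ →ₗ[ℝ] F) (L : Ψ →ₗ[ℝ] ℝ) {C : ℝ}
    (hC : 0 ≤ C) (h : ∀ ψ, |L ψ| ≤ C * ‖B ψ‖) : ∃ u : F, ‖u‖ ≤ C ∧ ∀ ψ, ⟪u, B ψ⟫ = L ψ := by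
  obtain ⟨σ, hσ⟩ := B.rangeRestrict.exists_rightInverse_of_surjective B.range_rangeRestrict
  have hσ' : ∀ y : LinearMap.range B, B (σ y) = y := fun y =>
    congrArg Subtype.val (LinearMap.congr_fun hσ y)
  let ℓ : LinearMap.range B →L[ℝ] ℝ := (L ∘ₗ σ).mkContinuous C fun y => by
    have := h (σ y)
    rwa [hσ'] at this
  obtain ⟨g, hg, hgn⟩ := _root_.exists_extension_norm_eq _ ℓ
  refine ⟨(InnerProductSpace.toDual ℝ F).symm g, ?_, fun ψ => ?_⟩
  · rw [LinearIsometryEquiv.norm_map, hgn]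
    exact LinearMap.mkContinuous_norm_le _ hC _
  · rw [InnerProductSpace.toDual_symm_apply, show g (B ψ) = ℓ ⟨B ψ, ψ, rfl⟩ from
      hg ⟨B ψ, ψ, rfl⟩]
    change L (σ ⟨B ψ, ψ, rfl⟩) = L ψ
    rw [← sub_eq_zero, ← map_sub, ← abs_nonpos_iff]
    refine (h _).trans_eq ?_
    rw [map_sub, hσ', sub_self, norm_zero, mul_zero]

theorem memLp_two_of_continuousOn {E : Type*} [NormedAddCommGroup E] {T : ℝ} {y : ℝ → E}
    (hy : ContinuousOn y (Icc 0 T)) : MemLp y 2 ((volume : Measure ℝ).restrict (Ioo 0 T)) := by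
  obtain ⟨K, hK⟩ := isCompact_Icc.exists_bound_of_continuousOn hy
  refine MemLp.of_bound ((hy.mono Ioo_subset_Icc_self).aestronglyMeasurable measurableSet_Ioo) K ?_
  exact (ae_restrict_iff' measurableSet_Ioo).2
    (Eventually.of_forall fun t ht => hK t (Ioo_subset_Icc_self ht))

theorem intervalIntegral_congr_ae_Ioo {E : Type*} [NormedAddCommGroup E] [NormedSpace ℝ E]
    {T : ℝ} {f g : ℝ → E} (h : f =ᵐ[(volume : Measure ℝ).restrict (Ioo 0 T)] g)
    {a b : ℝ} (ha : 0 ≤ a) (hab : a ≤ b) (hb : b ≤ T) :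
    ∫ s in a..b, f s = ∫ s in a..b, g s := by
  rw [intervalIntegral.integral_of_le hab, intervalIntegral.integral_of_le hab,
    integral_Ioc_eq_integral_Ioo, integral_Ioc_eq_integral_Ioo]
  exact integral_congr_ae (ae_restrict_of_ae_restrict_of_subset (Ioo_subset_Ioo ha hb) h)

theorem L2.intervalIntegrable {E : Type*} [NormedAddCommGroup E] {T : ℝ} (hT : 0 ≤ T)
    (ψ : L2 T E) {a b : ℝ} (ha : a ∈ Icc 0 T)
    (hb : b ∈ Icc 0 T) : IntervalIntegrable ψ volume a b :=
  (intervalIntegrable_of_memLp_two hT (Lp.memLp ψ)).mono_set (by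
    rw [uIcc_of_le hT]
    exact uIcc_subset_Icc ha hb)

theorem exists_backward_primitive {E : Type*} [NormedAddCommGroup E] [NormedSpace ℝ E]
    {T : ℝ} (hT : 0 ≤ T) :
    ∃ K : L2 T E →ₗ[ℝ] L2 T E, ∀ ψ : L2 T E,
      K ψ =ᵐ[(volume : Measure ℝ).restrict (Ioo 0 T)] fun t => ∫ s in t..T, ψ s := by
  have hmem : ∀ ψ : L2 T E, MemLp (fun t => ∫ s in t..T, ψ s) 2
      ((volume : Measure ℝ).restrict (Ioo 0 T)) := fun ψ => by
    refine memLp_two_of_continuousOn ?_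
    have h := intervalIntegral.continuousOn_primitive_interval_left (μ := volume) (f := ψ) (a := 0)
      (b := T) (by
        rw [uIcc_of_le hT]
        exact (intervalIntegrable_iff_integrableOn_Icc_of_le hT).1
          (intervalIntegrable_of_memLp_two hT (Lp.memLp ψ)))
    rwa [uIcc_of_le hT] at h
  have hTT : T ∈ Icc 0 T := ⟨hT, le_rfl⟩
  refine ⟨⟨⟨fun ψ => (hmem ψ).toLp _, fun ψ ψ' => ?_⟩, fun r ψ => ?_⟩, fun ψ =>
    (hmem ψ).coeFn_toLp⟩
  · rw [← MemLp.toLp_add]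
    refine (MemLp.toLp_eq_toLp_iff _ _).2 ?_
    filter_upwards [ae_restrict_mem measurableSet_Ioo] with t ht
    have ht' := Ioo_subset_Icc_self ht
    rw [intervalIntegral_congr_ae_Ioo (Lp.coeFn_add ψ ψ') ht.1.le ht.2.le le_rfl]
    exact intervalIntegral.integral_add (L2.intervalIntegrable hT ψ ht' hTT)
      (L2.intervalIntegrable hT ψ' ht' hTT)
  · rw [RingHom.id_apply, ← MemLp.toLp_const_smul]
    refine (MemLp.toLp_eq_toLp_iff (hmem (r • ψ)) _).2 ?_
    filter_upwards [ae_restrict_mem measurableSet_Ioo] with t ht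
    rw [intervalIntegral_congr_ae_Ioo (Lp.coeFn_smul r ψ) ht.1.le ht.2.le le_rfl]
    exact intervalIntegral.integral_smul _ _

variable {H : Type*} [NormedAddCommGroup H] [InnerProductSpace ℝ H] [CompleteSpace H]
  {V : Type*} [NormedAddCommGroup V] [InnerProductSpace ℝ V] [CompleteSpace V]

/-- Existence for `(ι† ι u)' + 𝒜 u = f`, `u(0) = u₀`, in integrated form, with the a priori bound.
The test functions are `K ψ = ∫ s in t..T, ψ s`, with `(K ψ)' = -ψ`, and the equation tested in this
way reads `⟪u, ι† ι ψ + 𝒜† K ψ⟫ = ⟪f, K ψ⟫ + ⟪u₀, ι (∫ ψ)⟫`. -/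
theorem exists_primitive_solution (ι : V →L[ℝ] H) {T : ℝ} (hT : 0 < T)
    (𝒜 : L2 T V →L[ℝ] L2 T V) {α : ℝ} (hα : 0 < α) (hco : ∀ w, α * ‖w‖ ^ 2 ≤ ⟪𝒜 w, w⟫)
    (f : L2 T V) (u₀ : H) :
    ∃ u : L2 T V, ‖u‖ ≤ ‖f‖ / α + √(2 / α) * ‖u₀‖ ∧
      ∀ᵐ t ∂(volume : Measure ℝ).restrict (Ioo 0 T),
        (ι†) (ι (u t)) = (ι†) u₀ + ∫ s in 0..t, (f - 𝒜 u : L2 T V) s := by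
  obtain ⟨K, hK⟩ := exists_backward_primitive (E := V) hT.le
  have h0T : (0 : ℝ) ∈ Icc 0 T := ⟨le_rfl, hT.le⟩
  have hTT : T ∈ Icc 0 T := ⟨hT.le, le_rfl⟩
  have hii : ∀ ψ : L2 T V, IntervalIntegrable ψ volume 0 T := fun ψ =>
    L2.intervalIntegrable hT.le ψ h0T hTT
  let S : L2 T V →L[ℝ] L2 T V := (ι† ∘L ι).compLpL 2 _
  have hS : ∀ ψ : L2 T V, S ψ =ᵐ[(volume : Measure ℝ).restrict (Ioo 0 T)]
      fun t => (ι†) (ι (ψ t)) := fun ψ => coeFn_compLpL _ ψ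
  let B : L2 T V →ₗ[ℝ] L2 T V := S.toLinearMap + (𝒜†).toLinearMap ∘ₗ K
  have hB : ∀ w ψ, ⟪w, B ψ⟫ = ⟪w, S ψ⟫ + ⟪𝒜 w, K ψ⟫ := fun w ψ => by
    change ⟪w, S ψ + (𝒜†) (K ψ)⟫ = _
    rw [inner_add_right, adjoint_inner_right]
  have hSsymm : ∀ w ψ, ⟪w, S ψ⟫ = ⟪S w, ψ⟫ := fun w ψ => by
    rw [L2.inner_def, L2.inner_def]
    refine integral_congr_ae ?_
    filter_upwards [hS w, hS ψ] with t h1 h2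
    rw [h1, h2, adjoint_inner_left, adjoint_inner_right]
  let L : L2 T V →ₗ[ℝ] ℝ :=
    { toFun := fun ψ => ⟪f, K ψ⟫ + ⟪u₀, ι (∫ s in 0..T, ψ s)⟫
      map_add' := fun ψ ψ' => by
        rw [intervalIntegral_congr_ae_Ioo (Lp.coeFn_add ψ ψ') le_rfl hT.le le_rfl]
        simp only [Pi.add_apply]
        rw [intervalIntegral.integral_add (hii ψ) (hii ψ'), map_add, map_add, inner_add_right,
          inner_add_right]
        ring
      map_smul' := fun r ψ => by
        rw [intervalIntegral_congr_ae_Ioo (Lp.coeFn_smul r ψ) le_rfl hT.le le_rfl]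
        simp only [Pi.smul_apply, RingHom.id_apply, intervalIntegral.integral_smul, map_smul,
          inner_smul_right, smul_eq_mul]
        ring }
  have hen : ∀ ψ : L2 T V, ⟪K ψ, S ψ⟫ = ‖ι (∫ s in 0..T, ψ s)‖ ^ 2 / 2 := by
    intro ψ
    have hιψ : IntervalIntegrable (fun t => ι (ψ t)) volume 0 T :=
      ⟨ι.integrable_comp (hii ψ).1, ι.integrable_comp (hii ψ).2⟩
    have h1 := integral_inner_integral_right_swap hT.le hιψ hιψ
    have h2 := two_mul_integral_inner_primitive hT.le hιψ 0
    simp only [zero_add, norm_zero] at h2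
    rw [ι.intervalIntegral_comp_comm (hii ψ)] at h2
    have h3 : ⟪K ψ, S ψ⟫ = ∫ t in 0..T, ⟪ι (ψ t), ∫ s in t..T, ι (ψ s)⟫ := by
      rw [L2.inner_def, intervalIntegral.integral_of_le hT.le, integral_Ioc_eq_integral_Ioo]
      refine integral_congr_ae ?_
      filter_upwards [hK ψ, hS ψ, ae_restrict_mem measurableSet_Ioo] with t hk hs ht
      rw [hk, hs, adjoint_inner_right, ι.intervalIntegral_comp_comm
        (L2.intervalIntegrable hT.le ψ (Ioo_subset_Icc_self ht) hTT), real_inner_comm]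
    rw [h3, h1]
    simp only [real_inner_comm _ (∫ t in 0..(_ : ℝ), ι (ψ t))]
    linarith
  have hbound : ∀ ψ, |L ψ| ≤ (‖f‖ / α + √(2 / α) * ‖u₀‖) * ‖B ψ‖ := by
    intro ψ
    set k := ‖K ψ‖ with hk
    set b := ‖B ψ‖ with hb
    set h := ‖ι (∫ s in 0..T, ψ s)‖ with hh
    have h1 : α * k ^ 2 + h ^ 2 / 2 ≤ k * b := by
      have := real_inner_le_norm (K ψ) (B ψ)
      rw [hB, hen] at this
      linarith [hco (K ψ)]
    have hk0 : 0 ≤ k := norm_nonneg _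
    have hb0 : 0 ≤ b := norm_nonneg _
    have hkb : k ≤ b / α := by
      rw [le_div_iff₀ hα]
      rcases hk0.eq_or_lt with h0 | h0
      · rw [← h0, zero_mul]; exact hb0
      · refine le_of_mul_le_mul_left ?_ h0
        nlinarith [sq_nonneg h]
    have hhb : h ≤ √(2 / α) * b := by
      refine le_of_sq_le_sq ?_ (by positivity)
      rw [mul_pow, Real.sq_sqrt (by positivity)]
      have h2 : k * b ≤ b / α * b := mul_le_mul_of_nonneg_right hkb hb0
      have h3 : 2 / α * b ^ 2 = 2 * (b / α * b) := by ring
      rw [h3]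
      nlinarith [mul_nonneg hα.le (sq_nonneg k)]
    calc |L ψ| ≤ |⟪f, K ψ⟫| + |⟪u₀, ι (∫ s in 0..T, ψ s)⟫| := abs_add_le _ _
      _ ≤ ‖f‖ * k + ‖u₀‖ * h := add_le_add (abs_real_inner_le_norm _ _) (abs_real_inner_le_norm _ _)
      _ ≤ ‖f‖ * (b / α) + ‖u₀‖ * (√(2 / α) * b) := by gcongr
      _ = _ := by ring
  obtain ⟨u, hu, hB'⟩ := exists_inner_eq_of_abs_le B L (by positivity) hbound
  refine ⟨u, hu, ?_⟩
  set q : L2 T V := f - 𝒜 u with hq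
  have hycont := continuousOn_const_add_integral hT.le (hii q) ((ι†) u₀)
  have hy := memLp_two_of_continuousOn hycont
  have hkey : S u = hy.toLp _ := by
    refine ext_inner_right ℝ fun ψ => ?_
    have h1 := hB' ψ
    rw [hB, hSsymm] at h1
    have h2 : ⟪S u, ψ⟫ = ⟪q, K ψ⟫ + ⟪(ι†) u₀, ∫ s in 0..T, ψ s⟫ := by
      rw [hq, inner_sub_left, adjoint_inner_left]
      change _ = ⟪f, K ψ⟫ + ⟪u₀, ι (∫ s in 0..T, ψ s)⟫ at h1
      linarith
    have h3 : ⟪q, K ψ⟫ = ∫ s in 0..T, ⟪∫ t in 0..s, q t, ψ s⟫ := by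
      rw [← integral_inner_integral_right_swap hT.le (hii q) (hii ψ), L2.inner_def,
        intervalIntegral.integral_of_le hT.le, integral_Ioc_eq_integral_Ioo]
      refine integral_congr_ae ?_
      filter_upwards [hK ψ] with t hk
      rw [hk]
    have hc : IntervalIntegrable (fun s => ⟪(ι†) u₀, ψ s⟫) volume 0 T := by
      simpa only [real_inner_comm] using
        intervalIntegrable_inner_of_continuousOn hT.le (hii ψ) (continuousOn_const (c := (ι†) u₀))
    have hi : IntervalIntegrable (fun s => ⟪∫ t in 0..s, q t, ψ s⟫) volume 0 T := by
      have := intervalIntegrable_inner_of_continuousOn hT.le (hii ψ)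
        (continuousOn_const_add_integral hT.le (hii q) 0)
      simpa only [zero_add, real_inner_comm] using this
    have h4 : ⟪(ι†) u₀, ∫ s in 0..T, ψ s⟫ = ∫ s in 0..T, ⟪(ι†) u₀, ψ s⟫ := by
      rw [intervalIntegral.integral_of_le hT.le, intervalIntegral.integral_of_le hT.le]
      exact (integral_inner ((intervalIntegrable_iff_integrableOn_Ioc_of_le hT.le).1 (hii ψ))
        _).symm
    rw [h2, h3, h4, ← intervalIntegral.integral_add hi hc, L2.inner_def,
      intervalIntegral.integral_of_le hT.le, integral_Ioc_eq_integral_Ioo]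
    refine integral_congr_ae ?_
    filter_upwards [hy.coeFn_toLp] with t ht
    rw [ht, ← inner_add_left, add_comm]
  filter_upwards [hS u, hy.coeFn_toLp] with t h1 h2
  rw [← h1, hkey, h2]

end Lions
/-! ### The weak problem as an equation in `L²(J; V)` -/

section Equation

open ContinuousLinearMap
open scoped InnerProduct

variable {V : Type*} [NormedAddCommGroup V] [InnerProductSpace ℝ V] [CompleteSpace V]

/-- The pointwise Riesz isomorphism `L²(J; V') → L²(J; V)`. -/
noncomputable def rieszL2 (T : ℝ) (g : L2 T (StrongDual ℝ V)) : L2 T V :=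
  (riesz (V := V)).toContinuousLinearEquiv.toContinuousLinearMap.compLp g

theorem coeFn_rieszL2 {T : ℝ} (g : L2 T (StrongDual ℝ V)) :
    rieszL2 T g =ᵐ[(volume : Measure ℝ).restrict (Ioo 0 T)] fun t => riesz (g t) :=
  coeFn_compLp _ g

theorem norm_rieszL2 {T : ℝ} (g : L2 T (StrongDual ℝ V)) : ‖rieszL2 T g‖ = ‖g‖ := by
  have h : ∀ᵐ t ∂(volume : Measure ℝ).restrict (Ioo 0 T), ‖rieszL2 T g t‖ = ‖g t‖ := by
    filter_upwards [coeFn_rieszL2 g] with t ht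
    rw [ht, LinearIsometryEquiv.norm_map]
  rw [Lp.norm_def, Lp.norm_def, eLpNorm_congr_norm_ae h]

theorem rieszL2_surjective (T : ℝ) : Function.Surjective (rieszL2 (V := V) T) := by
  intro q
  let g : L2 T (StrongDual ℝ V) :=
    (riesz (V := V)).symm.toContinuousLinearEquiv.toContinuousLinearMap.compLp q
  have hg : g =ᵐ[(volume : Measure ℝ).restrict (Ioo 0 T)] fun t => riesz.symm (q t) :=
    coeFn_compLp _ q
  refine ⟨g, Lp.ext ?_⟩
  filter_upwards [coeFn_rieszL2 g, hg] with t h1 h2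
  rw [h1, h2, LinearIsometryEquiv.apply_symm_apply]

theorem inner_rieszL2 {T : ℝ} (g : L2 T (StrongDual ℝ V)) (v : L2 T V) :
    ⟪rieszL2 T g, v⟫ = ∫ t in Ioo 0 T, g t (v t) := by
  rw [L2.inner_def]
  refine integral_congr_ae ?_
  filter_upwards [coeFn_rieszL2 g] with t ht
  rw [ht, inner_riesz]

theorem integrable_apply {T : ℝ} (g : L2 T (StrongDual ℝ V)) (v : L2 T V) :
    Integrable (fun t => g t (v t)) ((volume : Measure ℝ).restrict (Ioo 0 T)) := by
  refine (L2.integrable_inner (𝕜 := ℝ) (rieszL2 T g) v).congr ?_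
  filter_upwards [coeFn_rieszL2 g] with t ht
  rw [ht, inner_riesz]

/-- The weak problem splits into the initial condition and the equation `u' = f - 𝒜 u` in `L²`. -/
theorem isSolution_iff {H : Type*} [NormedAddCommGroup H] [InnerProductSpace ℝ H] (ι : V →L[ℝ] H)
    {T : ℝ} {A : ℝ → V →ₗ[ℝ] StrongDual ℝ V}
    {𝒜 : L2 T V →L[ℝ] L2 T V} (h𝒜 : ∀ w v, ⟪𝒜 w, v⟫ = ∫ t in Ioo 0 T, A t (w t) (v t))
    (hint : ∀ w v : L2 T V,
      Integrable (fun t => A t (w t) (v t)) ((volume : Measure ℝ).restrict (Ioo 0 T)))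
    (f : L2 T (StrongDual ℝ V)) (u₀ : H) (u : SpaceX ι T) :
    IsSolution ι T A f u₀ u ↔ IsInitialValue ι T (u : L2 T V) u₀ ∧
      rieszL2 T (weakDeriv u) = rieszL2 T f - 𝒜 u := by
  have hweak : ∀ (h : H) (v₁ : L2 T V) (v₂ : H),
      ((∫ t in Ioo 0 T, (weakDeriv u t (v₁ t) + A t ((u : L2 T V) t) (v₁ t))) + ⟪h, v₂⟫
        = (∫ t in Ioo 0 T, f t (v₁ t)) + ⟪u₀, v₂⟫) ↔
      ⟪rieszL2 T (weakDeriv u) - (rieszL2 T f - 𝒜 u), v₁⟫ + ⟪h - u₀, v₂⟫ = 0 := by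
    intro h v₁ v₂
    rw [integral_add (integrable_apply _ _) (hint _ _), ← inner_rieszL2, ← inner_rieszL2, ← h𝒜]
    simp only [inner_sub_left]
    constructor <;> intro h <;> linarith
  simp only [IsSolution, hweak]
  constructor
  · rintro ⟨h, hh, heq⟩
    have h1 : h = u₀ := by
      have := heq 0 (h - u₀)
      rwa [inner_zero_right, zero_add, inner_self_eq_zero, sub_eq_zero] at this
    subst h1
    refine ⟨hh, ?_⟩
    have := heq (rieszL2 T (weakDeriv u) - (rieszL2 T f - 𝒜 u)) 0
    rwa [inner_zero_right, add_zero, inner_self_eq_zero, sub_eq_zero] at this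
  · rintro ⟨hh, heq⟩
    exact ⟨u₀, hh, fun v₁ v₂ => by rw [heq]; simp⟩

variable {H : Type*} [NormedAddCommGroup H] [InnerProductSpace ℝ H] [CompleteSpace H]

theorem adjoint_injective_of_denseRange {ι : V →L[ℝ] H} (hι : DenseRange ι) :
    Function.Injective (ι†) := by
  refine (injective_iff_map_eq_zero _).2 fun x hx => ?_
  refine hι.eq_zero_of_inner_left (𝕜 := ℝ) fun v => ?_
  rw [← adjoint_inner_left, hx, inner_zero_left]

/-- The constant of integration of a function in `L²(J; V) ∩ H¹(J; V')` is its initial value. -/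
theorem ae_eq_add_integral_of_isInitialValue (ι : V →L[ℝ] H) {T : ℝ} (hT : 0 < T) {u : L2 T V}
    {g : L2 T (StrongDual ℝ V)} {h : H} (hu : IsInitialValue ι T u h)
    (hg : HasWeakDeriv ι T u g) :
    ∀ᵐ t ∂(volume : Measure ℝ).restrict (Ioo 0 T),
      (ι†) (ι (u t)) = (ι†) h + ∫ s in 0..t, rieszL2 T g s := by
  obtain ⟨c, hc⟩ := (hasWeakDeriv_iff_primitive ι hT u g).1 hg
  obtain ⟨U, hU, hUu, rfl⟩ := hu
  have hgi : IntervalIntegrable (fun t => rieszL2 T g t) volume 0 T :=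
    intervalIntegrable_of_memLp_two hT.le (Lp.memLp (rieszL2 T g))
  have hc' : ∀ᵐ t ∂(volume : Measure ℝ).restrict (Ioo 0 T),
      (ι†) (ι (u t)) = c + ∫ s in 0..t, rieszL2 T g s := by
    filter_upwards [hc, ae_restrict_mem measurableSet_Ioo] with t ht htT
    rw [ht, intervalIntegral_congr_ae_Ioo (coeFn_rieszL2 g) le_rfl htT.1.le htT.2.le]
  have heq : EqOn (fun t => (ι†) (U t)) (fun t => c + ∫ s in 0..t, rieszL2 T g s) (Icc 0 T) := by
    refine Measure.eqOn_Icc_of_ae_eq volume hT.ne ?_ ((ι†).continuous.comp_continuousOn hU)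
      (continuousOn_const_add_integral hT.le hgi c)
    rw [← restrict_Ioo_eq_restrict_Icc]
    filter_upwards [hc', hUu] with t h1 h2
    rw [h2, h1]
  have h0 := heq ⟨le_rfl, hT.le⟩
  simp only [intervalIntegral.integral_same, add_zero] at h0
  rwa [h0]

theorem isSolution_unique {ι : V →L[ℝ] H} (hinj : Function.Injective ι) (hdense : DenseRange ι)
    {T : ℝ} (hT : 0 < T) {𝒜 : L2 T V →L[ℝ] L2 T V} {α : ℝ} (hα : 0 < α)
    (hco : ∀ w, α * ‖w‖ ^ 2 ≤ ⟪𝒜 w, w⟫) {f : L2 T V} {u₀ : H} {u w : SpaceX ι T}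
    (hu : IsInitialValue ι T (u : L2 T V) u₀) (hu' : rieszL2 T (weakDeriv u) = f - 𝒜 u)
    (hw : IsInitialValue ι T (w : L2 T V) u₀) (hw' : rieszL2 T (weakDeriv w) = f - 𝒜 w) :
    w = u := by
  have h1 := ae_eq_add_integral_of_isInitialValue ι hT hu ((hasWeakDeriv_iff u _).2 rfl)
  have h2 := ae_eq_add_integral_of_isInitialValue ι hT hw ((hasWeakDeriv_iff w _).2 rfl)
  rw [hu'] at h1
  rw [hw'] at h2
  set z : L2 T V := (w : L2 T V) - u with hz
  have hq : (f - 𝒜 w) - (f - 𝒜 u) = -𝒜 z := by rw [hz, map_sub]; abel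
  have hzeq : ∀ᵐ t ∂(volume : Measure ℝ).restrict (Ioo 0 T),
      (ι†) (ι (z t)) = 0 + ∫ s in 0..t, (-𝒜 z : L2 T V) s := by
    filter_upwards [h1, h2, Lp.coeFn_sub (w : L2 T V) u, ae_restrict_mem measurableSet_Ioo]
      with t k1 k2 k3 ht
    have htT := Ioo_subset_Icc_self ht
    have h0T : (0 : ℝ) ∈ Icc 0 T := ⟨le_rfl, hT.le⟩
    rw [k3, Pi.sub_apply, map_sub, map_sub, k1, k2, ← hq,
      intervalIntegral_congr_ae_Ioo (Lp.coeFn_sub (f - 𝒜 w) (f - 𝒜 u)) le_rfl ht.1.le ht.2.le]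
    simp only [Pi.sub_apply]
    rw [intervalIntegral.integral_sub (L2.intervalIntegrable hT.le _ h0T htT)
      (L2.intervalIntegrable hT.le _ h0T htT)]
    abel
  obtain ⟨W, -, -, hW, hen⟩ :=
    exists_continuous_representative ι hinj hT (Lp.memLp z) (Lp.memLp (-𝒜 z)) hzeq
  have hW0 : W 0 = 0 := by
    refine adjoint_injective_of_denseRange hdense ?_
    rw [hW 0 ⟨le_rfl, hT.le⟩]
    simp
  rw [hW0, norm_zero] at hen
  have hen' : ‖W T‖ ^ 2 - 0 ^ 2 = 2 * ⟪-𝒜 z, z⟫ := by rw [hen, L2.inner_def]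
  rw [inner_neg_left] at hen'
  have hz0 : ‖z‖ ^ 2 ≤ 0 := by
    by_contra hcon
    nlinarith [hco z, sq_nonneg ‖W T‖, mul_pos hα (not_le.1 hcon)]
  have : z = 0 := by
    rw [← norm_eq_zero]
    exact pow_eq_zero_iff two_ne_zero |>.1 (le_antisymm hz0 (sq_nonneg _))
  exact Subtype.ext (sub_eq_zero.1 this)

end Equation
end Parabolic

theorem theorem36 (M α : ℝ) (hM : 0 < M) (hα : 0 < α) :
    ∃ C : ℝ, 0 < C ∧
      ∀ (H : Type u) [NormedAddCommGroup H] [InnerProductSpace ℝ H] [CompleteSpace H]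
        (V : Type v) [NormedAddCommGroup V] [InnerProductSpace ℝ V] [CompleteSpace V]
        (ι : V →L[ℝ] H) (_ : Function.Injective ι) (_ : DenseRange ι)
        (T : ℝ) (_ : 0 < T)
        (A : ℝ → V →ₗ[ℝ] StrongDual ℝ V)
        (_ : ∀ w v : V, AEMeasurable (fun t => A t w v)
          ((MeasureTheory.volume : MeasureTheory.Measure ℝ).restrict (Set.Ioo 0 T)))
        (_ : ∀ᵐ t ∂(MeasureTheory.volume : MeasureTheory.Measure ℝ).restrict (Set.Ioo 0 T),
          (∀ w v : V, A t w v ≤ M * ‖w‖ * ‖v‖) ∧ (∀ v : V, α * ‖v‖ ^ 2 ≤ A t v v))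
        (f : Parabolic.L2 T (StrongDual ℝ V)) (u₀ : H),
        ∃ u : Parabolic.SpaceX ι T,
          Parabolic.IsSolution ι T A f u₀ u ∧
          (∀ w : Parabolic.SpaceX ι T, Parabolic.IsSolution ι T A f u₀ w → w = u) ∧
          Parabolic.normX u ≤ C * (‖f‖ + ‖u₀‖) := by
  refine ⟨1 + (1 + M) * (1 / α + √(2 / α)), by positivity, ?_⟩
  intro H _ _ _ V _ _ _ ι hinj hdense T hT A hmeas hA f u₀
  have hbd := hA.mono fun t h => h.1
  obtain ⟨𝒜, h𝒜, hnorm, hco⟩ :=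
    Parabolic.exists_form_operator hM.le hmeas hbd (hA.mono fun t h => h.2)
  have hiff := Parabolic.isSolution_iff ι h𝒜 (Parabolic.integrable_form hM.le hmeas hbd) f u₀
  obtain ⟨u, hu, hueq⟩ :=
    Parabolic.exists_primitive_solution ι hT 𝒜 hα hco (Parabolic.rieszL2 T f) u₀
  obtain ⟨g, hg⟩ := Parabolic.rieszL2_surjective T (Parabolic.rieszL2 T f - 𝒜 u)
  have hweak : Parabolic.HasWeakDeriv ι T u g := by
    refine (Parabolic.hasWeakDeriv_iff_primitive ι hT u g).2
      ⟨ContinuousLinearMap.adjoint ι u₀, ?_⟩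
    filter_upwards [hueq, ae_restrict_mem measurableSet_Ioo] with t ht htT
    rw [ht, ← hg, Parabolic.intervalIntegral_congr_ae_Ioo (Parabolic.coeFn_rieszL2 g) le_rfl
      htT.1.le htT.2.le]
  let uX : Parabolic.SpaceX ι T := ⟨u, g, hweak⟩
  have hderiv : Parabolic.weakDeriv uX = g := (Parabolic.hasWeakDeriv_iff uX g).1 hweak
  have hinit : Parabolic.IsInitialValue ι T u u₀ := by
    obtain ⟨W, hWc, hWu, hW, -⟩ := Parabolic.exists_continuous_representative ι hinj hT
      (Lp.memLp u) (Lp.memLp (Parabolic.rieszL2 T f - 𝒜 u)) hueq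
    refine ⟨W, hWc, hWu, Parabolic.adjoint_injective_of_denseRange hdense ?_⟩
    rw [hW 0 ⟨le_rfl, hT.le⟩]
    simp
  refine ⟨uX, (hiff uX).2 ⟨hinit, by rw [hderiv, hg]⟩, fun w hw => ?_, ?_⟩
  · exact Parabolic.isSolution_unique hinj hdense hT hα hco hinit (by rw [hderiv, hg])
      ((hiff w).1 hw).1 ((hiff w).1 hw).2
  · have hgn : ‖g‖ ≤ ‖f‖ + M * ‖u‖ := by
      rw [← Parabolic.norm_rieszL2 g, ← Parabolic.norm_rieszL2 f, hg]
      exact (norm_sub_le _ _).trans (add_le_add le_rfl (hnorm u))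
    have hun : ‖u‖ ≤ (1 / α + √(2 / α)) * (‖f‖ + ‖u₀‖) := by
      rw [Parabolic.norm_rieszL2] at hu
      have h1 : 0 ≤ 1 / α * ‖u₀‖ := by positivity
      have h2 : 0 ≤ √(2 / α) * ‖f‖ := by positivity
      have h3 : ‖f‖ / α = 1 / α * ‖f‖ := by ring
      rw [h3] at hu
      linarith
    have hX : Parabolic.normX uX ≤ ‖u‖ + ‖g‖ := by
      rw [Parabolic.normX, hderiv]
      refine Real.sqrt_le_iff.2 ⟨by positivity, ?_⟩
      change ‖u‖ ^ 2 + ‖g‖ ^ 2 ≤ _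
      nlinarith [mul_nonneg (norm_nonneg u) (norm_nonneg g)]
    have hMu := mul_le_mul_of_nonneg_left hun (show 0 ≤ 1 + M by positivity)
    linarith [norm_nonneg u₀]
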